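/- For $k,c,n\in\mathbb N$ a $k$-AP of $[n]=\{1,\dots,n\}$ is a progression $a,a+d,\dots,a+(k-1)d$ with $a,d\ge 1$ and all members in $[n]$; a $c$-coloring of $[n]$ is proper if no $k$-AP of $[n]$ is monochromatic; and $W(k,c)$ is the least $W$ such that $[W]$ has no proper $c$-coloring. For $k\ge 1$ put $n'=n'(k)=\frac{2^{k-1}}{ek}$ and $f(k)=n'-1$. For integers $n,t\ge 0$ let $\mathrm{MT}(k,n,t)$ be the following algorithm of Moser and Tardos. Color $1,\dots,n$ with independent fair random bits. While there is a monochromatic $k$-AP $E$ of $[n]$, give each number in $E$ a fresh independent fair random color; but if some number would thereby be recolored more than $t$ times, stop and report failure. When no monochromatic $k$-AP is left, output the coloring. Then $W(k,2)\ge \frac{2^{k-1}}{ek}-1$ for all $k\ge 1$, by a randomized-constructive proof which runs this algorithm. That is, $W(k,2)\ge f(k)$ for all $k\ge 1$, and there is a single randomized program (for a random access machine with registers, an indirectly addressed memory, addition, truncated subtraction and fair coin tosses, each elementary instruction and each test costing one step), together with $\varepsilon(k)=\Theta\!\left(\frac1{n'k}\right)$, the integers $$n(k)=\left\lfloor \frac{2^{(k-1)(1-\varepsilon(k))}}{ek}\right\rfloor,\qquad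 \frac{2^{(k-1)(1-\varepsilon(k))}}{ek}\ \ge\ \frac{2^{k-1}}{ek}-1,$$ and integers $t(k)\ge 0$ with $t(k)=O(\varepsilon(k)^{-1.01})$, such that for every input $k\ge 1$: 1. for every sequence of coin tosses the program carries out a run of $\mathrm{MT}(k,n(k),t(k))$ with these tosses (for some choice of the progressions $E$) and reports its result; 2. it always outputs either a proper $2$-coloring of an interval $[m]$ with $m\ge\lfloor f(k)\rfloor$ (hence of all positive integers $\le f(k)$), or the statement "I have failed"; 3. with probability at least $2/3$ it outputs such a proper $2$-coloring; 4. it always halts after a number of steps bounded by a fixed polynomial in $f(k)$. -/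

import Mathlib

noncomputable section

namespace VdW

/-! ### Arithmetic progressions, proper colorings, van der Waerden numbers -/

/-- `{a, a + d, …, a + (k-1) d}` is a `k`-term arithmetic progression contained in
`[n] = {1, …, n}` (with `a, d ≥ 1`). -/
def IsAP (k n a d : ℕ) : Prop :=
  1 ≤ a ∧ 1 ≤ d ∧ a + (k - 1) * d ≤ n

/-- All members of the progression `{a, a + d, …, a + (k-1) d}` have the same color. -/
def Mono (k : ℕ) (col : ℕ → ℕ) (a d : ℕ) : Prop :=
  ∀ i < k, col (a + i * d) = col a

/-- `col` restricts to a proper coloring of `[n] = {1, …, n}` with the `c` colors `0, …, c - 1`: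
there is no monochromatic `k`-term progression in `[n]`. Values outside `[n]` are irrelevant. -/
def IsProper (k c n : ℕ) (col : ℕ → ℕ) : Prop :=
  (∀ x, 1 ≤ x → x ≤ n → col x < c) ∧ ∀ a d, IsAP k n a d → ¬ Mono k col a d

/-- The van der Waerden number `W(k, c)`: the least `W` such that `[W]` has no proper
`c`-coloring. -/
def vdW (k c : ℕ) : ℕ :=
  sInf {W : ℕ | ¬ ∃ col : ℕ → ℕ, IsProper k c W col}

/-! ### Randomized random access machines with a step count -/

/-- Programs of a random access machine with natural-number registers, a natural-number memory
with indirect addressing, addition and truncated subtraction, and coin tosses. Since a step at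
most doubles the largest number in use, unit-cost running time on this machine agrees up to
polynomials with Turing machine time. -/
inductive Prog : Type
  /-- `reg i := c` -/
  | const (i c : ℕ) : Prog
  /-- `reg i := reg j + reg l` -/
  | add (i j l : ℕ) : Prog
  /-- `reg i := max (reg j - reg l) 0` -/
  | sub (i j l : ℕ) : Prog
  /-- `reg i := mem (reg j)` -/
  | load (i j : ℕ) : Prog
  /-- `mem (reg i) := reg j` -/
  | store (i j : ℕ) : Prog
  /-- `reg i :=` a fresh random bit -/
  | toss (i : ℕ) : Prog
  /-- first `p`, then `q` -/
  | seq (p q : Prog) : Prog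
  /-- if `reg i ≠ 0` then `p` else `q` -/
  | branch (i : ℕ) (p q : Prog) : Prog
  /-- while `reg i ≠ 0` do `p` -/
  | loop (i : ℕ) (p : Prog) : Prog

/-- A machine state: registers, memory, and the number of coins tossed so far. -/
@[ext]
structure State where
  reg : ℕ → ℕ
  mem : ℕ → ℕ
  tossed : ℕ

/-- The state `s` with the value `v` written into register `i`. -/
def State.setReg (s : State) (i v : ℕ) : State :=
  { s with reg := Function.update s.reg i v }

/-- `Exec ω p s s' τ`: with the coin tosses `ω 0, ω 1, …`, the program `p` started in state `s`
halts in state `s'` after exactly `τ` steps. Each elementary instruction and each test of a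
register is one step. -/
inductive Exec (ω : ℕ → Bool) : Prog → State → State → ℕ → Prop
  | const (i c : ℕ) (s : State) : Exec ω (.const i c) s (s.setReg i c) 1
  | add (i j l : ℕ) (s : State) : Exec ω (.add i j l) s (s.setReg i (s.reg j + s.reg l)) 1
  | sub (i j l : ℕ) (s : State) : Exec ω (.sub i j l) s (s.setReg i (s.reg j - s.reg l)) 1
  | load (i j : ℕ) (s : State) : Exec ω (.load i j) s (s.setReg i (s.mem (s.reg j))) 1
  | store (i j : ℕ) (s : State) :
      Exec ω (.store i j) s { s with mem := Function.update s.mem (s.reg i) (s.reg j) } 1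
  | toss (i : ℕ) (s : State) :
      Exec ω (.toss i) s { s.setReg i (ω s.tossed).toNat with tossed := s.tossed + 1 } 1
  | seq {p q : Prog} {s s' s'' : State} {τ τ' : ℕ} :
      Exec ω p s s' τ → Exec ω q s' s'' τ' → Exec ω (.seq p q) s s'' (τ + τ')
  | branch_pos {i : ℕ} {p q : Prog} {s s' : State} {τ : ℕ} :
      s.reg i ≠ 0 → Exec ω p s s' τ → Exec ω (.branch i p q) s s' (τ + 1)
  | branch_zero {i : ℕ} {p q : Prog} {s s' : State} {τ : ℕ} :
      s.reg i = 0 → Exec ω q s s' τ → Exec ω (.branch i p q) s s' (τ + 1)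
  | loop_pos {i : ℕ} {p : Prog} {s s' s'' : State} {τ τ' : ℕ} :
      s.reg i ≠ 0 → Exec ω p s s' τ → Exec ω (.loop i p) s' s'' τ' →
        Exec ω (.loop i p) s s'' (τ + τ' + 1)
  | loop_zero {i : ℕ} {p : Prog} {s : State} :
      s.reg i = 0 → Exec ω (.loop i p) s s 1

/-- For given coin tosses the machine is deterministic: final state and running time are unique. -/
theorem Exec.unique {ω : ℕ → Bool} {p : Prog} {s s₁ s₂ : State} {τ₁ τ₂ : ℕ}
    (h₁ : Exec ω p s s₁ τ₁) (h₂ : Exec ω p s s₂ τ₂) : s₁ = s₂ ∧ τ₁ = τ₂ := by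
  induction h₁ generalizing s₂ τ₂ with
  | const | add | sub | load | store | toss => cases h₂; exact ⟨rfl, rfl⟩
  | seq _ _ ih ih' =>
    cases h₂ with
    | seq a b => obtain ⟨rfl, rfl⟩ := ih a; obtain ⟨rfl, rfl⟩ := ih' b; exact ⟨rfl, rfl⟩
  | branch_pos h _ ih =>
    cases h₂ with
    | branch_pos _ a => obtain ⟨rfl, rfl⟩ := ih a; exact ⟨rfl, rfl⟩
    | branch_zero h' _ => exact absurd h' h
  | branch_zero h _ ih =>
    cases h₂ with
    | branch_pos h' _ => exact absurd h h'
    | branch_zero _ a => obtain ⟨rfl, rfl⟩ := ih a; exact ⟨rfl, rfl⟩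
  | loop_pos h _ _ ih ih' =>
    cases h₂ with
    | loop_pos _ a b => obtain ⟨rfl, rfl⟩ := ih a; obtain ⟨rfl, rfl⟩ := ih' b; exact ⟨rfl, rfl⟩
    | loop_zero h' => exact absurd h' h
  | loop_zero h =>
    cases h₂ with
    | loop_pos h' _ _ => exact absurd h h'
    | loop_zero _ => exact ⟨rfl, rfl⟩

/-- The start state on input `k`: register `0` holds `k`, everything else is `0`. -/
def State.init (k : ℕ) : State where
  reg := fun i => if i = 0 then k else 0
  mem := fun _ => 0
  tossed := 0

/-- The law of an infinite sequence of independent fair coin tosses. -/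
def coins : MeasureTheory.Measure (ℕ → Bool) :=
  MeasureTheory.Measure.infinitePi fun _ : ℕ => (PMF.uniformOfFintype Bool).toMeasure

/-- The final state `s` is the announcement "I have failed" (register `0` holds `0`). -/
def State.Failed (s : State) : Prop :=
  s.reg 0 = 0

/-- The final state `s` is the output of a coloring of `[n]`: register `0` holds `1`, register `1`
holds `n`, and the color of `x ∈ [n]` is in memory cell `x`. -/
def State.Outputs (s : State) (n : ℕ) (col : ℕ → ℕ) : Prop :=
  s.reg 0 = 1 ∧ s.reg 1 = n ∧ ∀ x, 1 ≤ x → x ≤ n → s.mem x = col x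

/-- The final state `s` is the output of a proper `c`-coloring of an interval `[n]` that contains
every positive integer `≤ r`. -/
def State.OutputsProper (s : State) (k c : ℕ) (r : ℝ) : Prop :=
  ∃ n col, ⌊r⌋₊ ≤ n ∧ IsProper k c n col ∧ s.Outputs n col

/-- The randomized program `p` makes the bound `W(k, c) ≥ f k` randomized-constructive: on every
input `k ≥ 1` it always outputs a proper `c`-coloring of `[f k]` or announces its failure, it
outputs a proper `c`-coloring with probability at least `2/3`, and it always halts within a
number of steps that is polynomial in `f k`. -/
def RandomizedConstructive (p : Prog) (c : ℕ) (f : ℕ → ℝ) : Prop :=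
  ∃ q : Polynomial ℝ, ∀ k : ℕ, 1 ≤ k →
    (∀ ω : ℕ → Bool, ∃ s τ, Exec ω p (State.init k) s τ ∧ (τ : ℝ) ≤ q.eval (f k) ∧
      (s.OutputsProper k c (f k) ∨ s.Failed)) ∧
    (2 / 3 : ENNReal) ≤
      coins {ω | ∃ s τ, Exec ω p (State.init k) s τ ∧ s.OutputsProper k c (f k)}

/-! ### The recoloring algorithm of Moser and Tardos -/

/-- The coloring `col` after the members `a + i d` (`i < k`) of a progression (`d ≥ 1`) have
received the new colors `bit i`. -/
def recolor (k a d : ℕ) (bit : ℕ → Bool) (col : ℕ → ℕ) : ℕ → ℕ := fun x =>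
  if a ≤ x ∧ d ∣ x - a ∧ (x - a) / d < k then (bit ((x - a) / d)).toNat else col x

/-- The recoloring counters after each member of the progression was recolored once. -/
def recount (k a d : ℕ) (cnt : ℕ → ℕ) : ℕ → ℕ := fun x =>
  if a ≤ x ∧ d ∣ x - a ∧ (x - a) / d < k then cnt x + 1 else cnt x

/-- The recoloring loop on `[n]` with coin tosses `ω`. `MTLoop k n t ω col cnt pos out`: from
the current coloring `col`, when each `x` was recolored `cnt x` times and `pos` coins have been
used, a run of the loop can end with `out`, which is `some col'` for a final coloring `col'` and
`none` for a failure. While there is a monochromatic `k`-term progression in `[n]`, such a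
progression is recolored with fresh random colors, except that the run fails if some number
would be recolored more than `t` times. -/
inductive MTLoop (k n t : ℕ) (ω : ℕ → Bool) :
    (ℕ → ℕ) → (ℕ → ℕ) → ℕ → Option (ℕ → ℕ) → Prop
  | done {col cnt : ℕ → ℕ} {pos : ℕ} :
      (∀ a d, IsAP k n a d → ¬ Mono k col a d) → MTLoop k n t ω col cnt pos (some col)
  | step {col cnt : ℕ → ℕ} {pos a d : ℕ} {out : Option (ℕ → ℕ)} :
      IsAP k n a d → Mono k col a d → (∀ i < k, cnt (a + i * d) < t) →
      MTLoop k n t ω (recolor k a d (fun i => ω (pos + i)) col) (recount k a d cnt) (pos + k) out →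
        MTLoop k n t ω col cnt pos out
  | fail {col cnt : ℕ → ℕ} {pos a d : ℕ} :
      IsAP k n a d → Mono k col a d → (∃ i < k, t ≤ cnt (a + i * d)) →
        MTLoop k n t ω col cnt pos none

/-- `out` is a result of the whole algorithm: the numbers `1, …, n` are first colored by the
first `n` coins, then the recoloring loop is run. -/
def MoserTardos (k n t : ℕ) (ω : ℕ → Bool) (out : Option (ℕ → ℕ)) : Prop :=
  MTLoop k n t ω (fun x => (ω (x - 1)).toNat) (fun _ => 0) n out

/-- The final state `s` reports the result `out` of the recoloring algorithm on `[n]`. -/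
def State.Reports (s : State) (n : ℕ) : Option (ℕ → ℕ) → Prop
  | some col => s.Outputs n col
  | none => s.Failed

/-- `n' = 2^(k-1) / (e k)`. -/
def nPrime (k : ℕ) : ℝ :=
  2 ^ (k - 1) / (Real.exp 1 * k)

end VdW

end

noncomputable section

namespace VdW

/-! The choice of `E` is free, so the program always recolors the lexicographically least
monochromatic progression. Its failure probability is bounded by an encoding argument. A run of `m`
rounds leaves a record: the word of recolored progressions, the color each had when it was treated,
and the final coloring of `[n]`. From the record all `n + k m` coins can be read off backwards
(`Chain.reconstruct`), so a given record has probability at most `2^-(n + k m)`. Each word belongs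
to at most `2^m 2^n` records, hence `m` rounds occur with probability at most the number of words
times `2^(-(k-1) m)` (`coins_chain_le`).

There are few words: once the least monochromatic progression `e` is recolored, every monochromatic
progression is either an earlier candidate above `e` or meets `e` (`Chain.mem_words`). If at most
`Δ` progressions meet a given one, there are at most `(e Δ)^m (1 + 1/Δ)^(n^2)` words, where the `e`
in `e Δ` is Euler's number (`card_words_le`). Boundary effects allow `Δ = n (k - 1/2)` instead of `n
k` (`card_neighbors_le`). For `n ≤ n'` a round therefore costs a factor `e Δ / 2^(k-1) ≤ 1 -
1/(2k)`, and `2 k (n + 2)` rounds have probability at most `exp(-2) ≤ 1/3` (`coins_chain_le_third`).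
Failure at threshold `t` needs at least `t` earlier rounds, so `t = 2 k (n + 2) = O(n' k) = O(1/ε)`
suffices.

The machine must find `n` in integer arithmetic. It replaces `e` by a partial sum of its series and
subtracts `1` from the quotient, which keeps a positive `n` between `n' - 2` and `n' - 3/4`; then
`ε` is solved for (`exists_exponent`). Every run halts because each completed recoloring uses up
part of the budget `∑ (t - cnt x)`. Since success has positive probability, a proper coloring
exists, which gives the bound on `W(k, 2)`. -/

/-! ### Words of a process that always treats the least remaining event -/

/-- The words of length `m` in which each letter is taken from the current set of candidates and,
after the letter `e`, only the candidates above `e` and the members of `Γ e` remain. -/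
def words {α : Type*} [LinearOrder α] (Γ : α → Finset α) : ℕ → Finset α → Finset (List α)
  | 0, _ => {[]}
  | m + 1, U => U.biUnion fun e => (words Γ m (U.filter (e < ·) ∪ Γ e)).image (List.cons e)

/-- Along the increasing order of `U` the exponents run through `|U| - 1, …, 0`, so this is a
geometric sum. -/
theorem sum_pow_card_filter_lt {α : Type*} [LinearOrder α] (y : ℝ) (U : Finset α) :
    (∑ e ∈ U, (1 + y) ^ (U.filter (e < ·)).card) * y = (1 + y) ^ U.card - 1 := by
  induction U using Finset.induction_on_min with
  | empty => simp
  | insert a U ha ih =>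
    have hna : a ∉ U := fun h => lt_irrefl _ (ha a h)
    have h1 : (insert a U).filter (a < ·) = U := by
      ext x
      simp only [Finset.mem_filter, Finset.mem_insert]
      constructor
      · rintro ⟨rfl | h, h'⟩
        · exact absurd h' (lt_irrefl _)
        · exact h
      · exact fun h => ⟨Or.inr h, ha x h⟩
    have h2 : ∀ e ∈ U, (insert a U).filter (e < ·) = U.filter (e < ·) := fun e he => by
      rw [Finset.filter_insert, if_neg (not_lt.2 (ha e he).le)]
    rw [Finset.sum_insert hna, h1, Finset.sum_congr rfl fun e he => by rw [h2 e he], add_mul, ih,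
      Finset.card_insert_of_notMem hna, pow_succ]
    ring

/-- The weight `(1 + y)^|U|` absorbs the branching. Choosing `e` leaves the part of `U` above `e`,
whose weights form a geometric sum of value less than `(1 + y)^|U| / y`, and adds `Γ e`, which costs
at most `B y`. The product is the factor `B` per letter. -/
theorem card_words_le {α : Type*} [LinearOrder α] {Γ : α → Finset α} {y B : ℝ} (hy : 0 < y)
    (hB0 : 0 ≤ B) (hB : ∀ e, (1 + y) ^ (Γ e).card ≤ B * y) (m : ℕ) (U : Finset α) :
    ((words Γ m U).card : ℝ) ≤ B ^ m * (1 + y) ^ U.card := by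
  induction m generalizing U with
  | zero => simpa [words] using one_le_pow₀ (by linarith)
  | succ m ih =>
    have hpos : ∀ j : ℕ, 0 < (1 + y) ^ j := fun j => pow_pos (by linarith) _
    calc ((words Γ (m + 1) U).card : ℝ)
        ≤ ∑ e ∈ U, ((words Γ m (U.filter (e < ·) ∪ Γ e)).card : ℝ) := by
          rw [words]
          exact_mod_cast Finset.card_biUnion_le.trans
            (Finset.sum_le_sum fun e _ => Finset.card_image_le)
      _ ≤ ∑ e ∈ U, B ^ m * ((1 + y) ^ (U.filter (e < ·)).card * (B * y)) := by
          refine Finset.sum_le_sum fun e _ => (ih _).trans ?_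
          refine mul_le_mul_of_nonneg_left ?_ (pow_nonneg hB0 _)
          calc (1 + y) ^ (U.filter (e < ·) ∪ Γ e).card
              ≤ (1 + y) ^ ((U.filter (e < ·)).card + (Γ e).card) :=
                pow_le_pow_right₀ (by linarith) (Finset.card_union_le _ _)
            _ ≤ _ := by
                rw [pow_add]
                exact mul_le_mul_of_nonneg_left (hB e) (hpos _).le
      _ = B ^ (m + 1) * ((∑ e ∈ U, (1 + y) ^ (U.filter (e < ·)).card) * y) := by
          rw [← Finset.mul_sum, ← Finset.sum_mul, pow_succ]
          ring
      _ ≤ B ^ (m + 1) * (1 + y) ^ U.card := by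
          rw [sum_pow_card_filter_lt]
          exact mul_le_mul_of_nonneg_left (by linarith) (pow_nonneg hB0 _)

/-! ### Events determined by finitely many coins -/

/-- Such a set lies in a single cylinder of depth `L`. Only monotonicity is used, so `S` need not be
measurable. -/
theorem coins_le_of_agree {L : ℕ} {S : Set (ℕ → Bool)}
    (h : ∀ ω ∈ S, ∀ ω' ∈ S, ∀ i < L, ω i = ω' i) : coins S ≤ 2⁻¹ ^ L := by
  rcases S.eq_empty_or_nonempty with rfl | ⟨ω₀, h₀⟩
  · simp
  have hsub : S ⊆ Set.pi (Finset.range L : Set ℕ) fun i => {ω₀ i} := fun ω hω i hi => by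
    simpa using h ω hω ω₀ h₀ i (by simpa using hi)
  refine (MeasureTheory.measure_mono hsub).trans ?_
  rw [coins, MeasureTheory.Measure.infinitePi_pi _ fun _ _ => MeasurableSet.singleton _]
  simp

instance : MeasureTheory.IsProbabilityMeasure coins := by
  unfold coins; infer_instance

/-! ### The process that recolors the least monochromatic progression -/

/-- `recolor` for colorings by bits. -/
def recolorBit (k a d : ℕ) (bit : ℕ → Bool) (c : ℕ → Bool) : ℕ → Bool := fun x =>
  if a ≤ x ∧ d ∣ x - a ∧ (x - a) / d < k then bit ((x - a) / d) else c x

theorem mem_progression_iff {k a d x : ℕ} (hd : 1 ≤ d) :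
    (a ≤ x ∧ d ∣ x - a ∧ (x - a) / d < k) ↔ ∃ i < k, x = a + i * d := by
  constructor
  · rintro ⟨h, ⟨i, hi⟩, h'⟩
    rw [hi, Nat.mul_div_cancel_left _ hd] at h'
    exact ⟨i, h', by rw [mul_comm i d, ← hi]; omega⟩
  · rintro ⟨i, hi, rfl⟩
    simp only [Nat.add_sub_cancel_left, Nat.mul_div_cancel _ hd]
    exact ⟨by omega, ⟨i, mul_comm _ _⟩, hi⟩

theorem recolor_toNat (k a d : ℕ) (bit c : ℕ → Bool) :
    recolor k a d bit (fun x => (c x).toNat) = fun x => (recolorBit k a d bit c x).toNat := by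
  funext x
  simp only [recolor, recolorBit]
  split_ifs <;> rfl

theorem recolorBit_mem {k a d i : ℕ} (hd : 1 ≤ d) (hi : i < k) (bit c : ℕ → Bool) :
    recolorBit k a d bit c (a + i * d) = bit i := by
  rw [recolorBit, if_pos ((mem_progression_iff hd).2 ⟨i, hi, rfl⟩)]
  simp [Nat.mul_div_cancel _ hd]

theorem recolorBit_of_ne {k a d x : ℕ} (hd : 1 ≤ d) (hx : ∀ i < k, x ≠ a + i * d)
    (bit c : ℕ → Bool) : recolorBit k a d bit c x = c x := by
  rw [recolorBit, if_neg fun h => ?_]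
  obtain ⟨i, hi, h⟩ := (mem_progression_iff hd).1 h
  exact hx i hi h

/-- `(a, d)` is the lexicographically least monochromatic progression. -/
def IsLeastMono (k n : ℕ) (c : ℕ → Bool) (a d : ℕ) : Prop :=
  (IsAP k n a d ∧ ∀ i < k, c (a + i * d) = c a) ∧
    ∀ a' d', IsAP k n a' d' → (∀ i < k, c (a' + i * d') = c a') → toLex (a, d) ≤ toLex (a', d')

theorem mono_toNat_iff {k a d : ℕ} {c : ℕ → Bool} :
    Mono k (fun x => (c x).toNat) a d ↔ ∀ i < k, c (a + i * d) = c a := by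
  have (x y : Bool) : x.toNat = y.toNat ↔ x = y := by cases x <;> cases y <;> decide
  simp only [Mono, this]

/-- Starting from the coloring `c` and the coin number `pos`, repeated recoloring of the least
monochromatic progression can treat the progressions in the list `w`, which have the colors in
the list `b` when they are treated, and thereby arrive at the final coloring. -/
inductive Chain (k n : ℕ) (ω : ℕ → Bool) :
    (ℕ → Bool) → ℕ → List (ℕ ×ₗ ℕ) → List Bool → (ℕ → Bool) → Prop
  | nil {c : ℕ → Bool} {pos : ℕ} : Chain k n ω c pos [] [] c
  | cons {c c' : ℕ → Bool} {pos a d : ℕ} {w : List (ℕ ×ₗ ℕ)} {b : List Bool} :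
      IsLeastMono k n c a d →
      Chain k n ω (recolorBit k a d (fun i => ω (pos + i)) c) (pos + k) w b c' →
      Chain k n ω c pos (toLex (a, d) :: w) (c a :: b) c'

theorem Chain.length_eq {k n pos : ℕ} {ω c c' : ℕ → Bool} {w : List (ℕ ×ₗ ℕ)} {b : List Bool}
    (h : Chain k n ω c pos w b c') : b.length = w.length := by
  induction h with
  | nil => rfl
  | cons _ _ ih => simp [ih]

theorem Chain.truncate {k n pos : ℕ} {ω c c' : ℕ → Bool} {w : List (ℕ ×ₗ ℕ)} {b : List Bool}
    (h : Chain k n ω c pos w b c') {m : ℕ} (hm : m ≤ w.length) :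
    ∃ w₁ b₁ c₁, w₁.length = m ∧ Chain k n ω c pos w₁ b₁ c₁ := by
  induction h generalizing m with
  | nil => exact ⟨[], [], _, by simpa [eq_comm] using hm, .nil⟩
  | cons hl h ih =>
    cases m with
    | zero => exact ⟨[], [], _, rfl, .nil⟩
    | succ m =>
      obtain ⟨w₁, b₁, c₁, hw, hc⟩ := ih (m := m) (by simpa using hm)
      exact ⟨_, _, c₁, by simp [hw], .cons hl hc⟩

/-- The coins used by a chain, and its initial coloring, can be reconstructed from the list of the
recolored progressions, their colors, and the final coloring. -/
theorem Chain.reconstruct {k n pos : ℕ} {ω ω' c₁ c₁' c₂ c₂' : ℕ → Bool} {w : List (ℕ ×ₗ ℕ)}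
    {b : List Bool} (h : Chain k n ω c₁ pos w b c₁') (h' : Chain k n ω' c₂ pos w b c₂')
    (heq : ∀ x, 1 ≤ x → x ≤ n → c₁' x = c₂' x) :
    (∀ x, 1 ≤ x → x ≤ n → c₁ x = c₂ x) ∧ ∀ j < k * w.length, ω (pos + j) = ω' (pos + j) := by
  induction h generalizing c₂ with
  | nil =>
    cases h'
    exact ⟨heq, fun j hj => by simp at hj⟩
  | @cons c c' pos a d w b hl h ih =>
    generalize hv : toLex (a, d) :: w = v at h'
    generalize hb : c a :: b = b' at h'
    cases h' with
    | nil => simp at hv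
    | @cons _ _ _ a₂ d₂ w₂ b₂ hl₂ h₂ =>
    obtain ⟨h1, rfl⟩ := List.cons.inj hv
    obtain ⟨h3, rfl⟩ := List.cons.inj hb
    obtain ⟨rfl, rfl⟩ := Prod.mk.inj (toLex_inj.1 h1)
    -- Backward reading of one round: the coloring after the round shows the `k` fresh coins on the
    -- progression and the old colors elsewhere; the overwritten colors on the progression all equal
    -- the recorded bit.
    obtain ⟨hc, hω⟩ := ih h₂ heq
    obtain ⟨⟨⟨ha, hd, hn⟩, hm⟩, -⟩ := hl
    obtain ⟨⟨-, hm₂⟩, -⟩ := hl₂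
    have hmem : ∀ i < k, 1 ≤ a + i * d ∧ a + i * d ≤ n := fun i hi =>
      ⟨by omega, le_trans (Nat.add_le_add_left (Nat.mul_le_mul_right _ (by omega)) _) hn⟩
    refine ⟨fun x hx hxn => ?_, fun j hj => ?_⟩
    · by_cases hx' : ∃ i < k, x = a + i * d
      · obtain ⟨i, hi, rfl⟩ := hx'
        rw [hm i hi, hm₂ i hi, h3]
      · push Not at hx'
        have := hc x hx hxn
        rwa [recolorBit_of_ne hd hx', recolorBit_of_ne hd hx'] at this
    · rcases lt_or_ge j k with hjk | hjk
      · have := hc _ (hmem j hjk).1 (hmem j hjk).2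
        rwa [recolorBit_mem hd hjk, recolorBit_mem hd hjk] at this
      · have := hω (j - k) (by rw [List.length_cons, mul_add] at hj; omega)
        rwa [show pos + k + (j - k) = pos + j by omega] at this

open Classical in
/-- The `k`-term progressions of `[n]`, as pairs of first member and difference. -/
def progressions (k n : ℕ) : Finset (ℕ ×ₗ ℕ) :=
  (((Finset.Icc 1 n ×ˢ Finset.Icc 1 n).filter fun e => IsAP k n e.1 e.2).image toLex)

open Classical in
/-- The `k`-term progressions of `[n]` that meet the progression `e`. -/
def neighbors (k n : ℕ) (e : ℕ ×ₗ ℕ) : Finset (ℕ ×ₗ ℕ) :=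
  (progressions k n).filter fun e' => ∃ i < k, ∃ j < k,
    (ofLex e').1 + i * (ofLex e').2 = (ofLex e).1 + j * (ofLex e).2

/-- For `k = 1` the difference of a progression is unbounded, so the box `[n] × [n]` would miss
some. -/
theorem mem_progressions {k n a d : ℕ} (hk : 2 ≤ k) :
    toLex (a, d) ∈ progressions k n ↔ IsAP k n a d := by
  simp only [progressions, Finset.mem_image, Finset.mem_filter, Finset.mem_product,
    Finset.mem_Icc, toLex_inj, exists_eq_right]
  refine ⟨fun h => h.2, fun h => ⟨?_, h⟩⟩
  obtain ⟨ha, hd, hn⟩ := h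
  have : d ≤ (k - 1) * d := Nat.le_mul_of_pos_left d (by omega)
  omega

theorem card_progressions_le (k n : ℕ) : (progressions k n).card ≤ n * n := by
  classical
  unfold progressions
  exact Finset.card_image_le.trans ((Finset.card_filter_le _ _).trans (by simp))

/-- The invariant is that `U` contains every monochromatic progression. One that is monochromatic
after `e` was recolored either meets `e` or has kept its colors; in the latter case it was
monochromatic before, so it lies in `U` and, by minimality, above `e`. Since `e` meets itself, it
may return through `neighbors`. -/
theorem Chain.mem_words {k n pos : ℕ} (hk : 2 ≤ k) {ω c c' : ℕ → Bool} {w : List (ℕ ×ₗ ℕ)}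
    {b : List Bool} (h : Chain k n ω c pos w b c') {U : Finset (ℕ ×ₗ ℕ)}
    (hU : ∀ a d, IsAP k n a d → (∀ i < k, c (a + i * d) = c a) → toLex (a, d) ∈ U) :
    w ∈ words (neighbors k n) w.length U := by
  induction h generalizing U with
  | nil => simp [words]
  | @cons c c' pos a d w b hl h ih =>
    simp only [List.length_cons, words, Finset.mem_biUnion, Finset.mem_image]
    refine ⟨toLex (a, d), hU a d hl.1.1 hl.1.2, w, ih fun a' d' hap hm => ?_, rfl⟩
    simp only [Finset.mem_union, Finset.mem_filter]
    by_cases hmeet : ∃ i < k, ∃ j < k, a' + i * d' = a + j * d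
    · exact Or.inr (Finset.mem_filter.2 ⟨(mem_progressions hk).2 hap, hmeet⟩)
    · push Not at hmeet
      have hold : ∀ i < k, recolorBit k a d (fun i => ω (pos + i)) c (a' + i * d') =
          c (a' + i * d') := fun i hi =>
        recolorBit_of_ne hl.1.1.2.1 (hmeet i hi) _ _
      have h0 := hold 0 (by omega)
      rw [zero_mul, add_zero] at h0
      have hm' : ∀ i < k, c (a' + i * d') = c a' := fun i hi => by
        rw [← hold i hi, hm i hi, h0]
      refine Or.inl ⟨hU a' d' hap hm', lt_of_le_of_ne (hl.2 a' d' hap hm') fun heq => ?_⟩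
      obtain ⟨rfl, rfl⟩ := Prod.mk.inj (toLex_inj.1 heq)
      exact hmeet 0 (by omega) 0 (by omega) rfl

/-- The probability that repeated recoloring of the least monochromatic progression goes on for
`m` rounds. -/
theorem coins_chain_le {k : ℕ} (hk : 2 ≤ k) (n m : ℕ) :
    coins {ω | ∃ w b c', w.length = m ∧ Chain k n ω (fun x => ω (x - 1)) n w b c'} ≤
      (words (neighbors k n) m (progressions k n)).card * (2 ^ m * 2 ^ n) * 2⁻¹ ^ (n + k * m) := by
  classical
  let I := words (neighbors k n) m (progressions k n) ×ˢ
    (Finset.univ : Finset (List.Vector Bool m × (Fin n → Bool)))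
  -- One event for each record: word, colors of the treated progressions, final colors of `[n]`.
  let S : List (ℕ ×ₗ ℕ) × (List.Vector Bool m × (Fin n → Bool)) → Set (ℕ → Bool) := fun p =>
    {ω | p.1.length = m ∧ ∃ c', Chain k n ω (fun x => ω (x - 1)) n p.1 p.2.1.toList c' ∧
      ∀ i : Fin n, c' (i + 1) = p.2.2 i}
  have hsub : {ω | ∃ w b c', w.length = m ∧ Chain k n ω (fun x => ω (x - 1)) n w b c'} ⊆
      ⋃ p ∈ I, S p := by
    rintro ω ⟨w, b, c', rfl, h⟩
    simp only [Set.mem_iUnion]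
    refine ⟨(w, ⟨b, h.length_eq⟩, fun i => c' (i + 1)), ?_, rfl, c', h, fun i => rfl⟩
    simp only [I, Finset.mem_product, Finset.mem_univ, and_true]
    exact h.mem_words hk fun a d hap _ => (mem_progressions hk).2 hap
  refine (MeasureTheory.measure_mono hsub).trans
    ((MeasureTheory.measure_biUnion_finset_le _ _).trans ?_)
  have hS : ∀ p ∈ I, coins (S p) ≤ 2⁻¹ ^ (n + k * m) := fun p _ => by
    refine coins_le_of_agree ?_
    rintro ω ⟨hw, c, h, hc⟩ ω' ⟨-, c', h', hc'⟩ i hi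
    obtain ⟨h0, h1⟩ := h.reconstruct h' fun x hx hxn => by
      have e1 := hc ⟨x - 1, by omega⟩
      have e2 := hc' ⟨x - 1, by omega⟩
      simp only [Nat.sub_add_cancel hx] at e1 e2
      rw [e1, e2]
    rcases lt_or_ge i n with hin | hin
    · simpa using h0 (i + 1) (by omega) (by omega)
    · have := h1 (i - n) (by rw [hw]; omega)
      rwa [show n + (i - n) = i by omega] at this
  refine (Finset.sum_le_card_nsmul _ _ _ hS).trans (le_of_eq ?_)
  simp only [I, Finset.card_product, Finset.card_univ, Fintype.card_prod, card_vector,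
    Fintype.card_fun, Fintype.card_bool, Fintype.card_fin, nsmul_eq_mul]
  push_cast
  ring

/-! ### Counting the progressions that meet a given one -/

/-- The differences of the progressions of `[n]` in which `x` is the member number `i`. -/
def differences (k n x i : ℕ) : Finset ℕ :=
  (Finset.Icc 1 n).filter fun d => i * d ≤ x - 1 ∧ (k - 1 - i) * d ≤ n - x

/-- A set of positive integers has at most as many elements as its maximum, and the maximum itself
satisfies both constraints. -/
theorem card_differences_mul_le (k n x i : ℕ) :
    i * (differences k n x i).card ≤ x - 1 ∧ (k - 1 - i) * (differences k n x i).card ≤ n - x := by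
  rcases (differences k n x i).eq_empty_or_nonempty with h | h
  · simp [h]
  have hmax := Finset.max'_mem _ h
  have hcard : (differences k n x i).card ≤ (differences k n x i).max' h := by
    refine (Finset.card_le_card (t := Finset.Icc 1 ((differences k n x i).max' h))
      fun d hd => ?_).trans (by simp)
    exact Finset.mem_Icc.2 ⟨(Finset.mem_Icc.1 (Finset.mem_filter.1 hd).1).1, Finset.le_max' _ d hd⟩
  obtain ⟨-, h1, h2⟩ := Finset.mem_filter.1 hmax
  exact ⟨(Nat.mul_le_mul_left _ hcard).trans h1, (Nat.mul_le_mul_left _ hcard).trans h2⟩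

/-- A position `i` admits at most `n / (k - 1)` differences. The end positions `0` and `k - 1` share
one such quota, because their constraints involve `n - x` and `x - 1`; this alone would give the
total `n`. The positions `1` and `k - 2` likewise share `n / (k - 2)`, and this second pair yields
the saving `n / (2k)`. -/
theorem sum_card_differences_le {k n x : ℕ} (hk : 5 ≤ k) (hx : 1 ≤ x) (hxn : x ≤ n) :
    ((∑ i ∈ Finset.range k, (differences k n x i).card : ℕ) : ℝ) ≤ n * (1 - 1 / (2 * k)) := by
  obtain ⟨K, rfl⟩ : ∃ K, k = K + 4 := ⟨k - 4, by omega⟩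
  set c : ℕ → ℕ := fun i => (differences (K + 4) n x i).card with hc
  have hle := fun i => card_differences_mul_le (K + 4) n x i
  have hmid : ∀ i < K, ((K : ℝ) + 3) * c (i + 2) ≤ n := fun i hi => by
    obtain ⟨h1, h2⟩ := hle (i + 2)
    have : (K + 3) * c (i + 2) ≤ n := by
      calc (K + 3) * c (i + 2) = (i + 2) * c (i + 2) + (K + 4 - 1 - (i + 2)) * c (i + 2) := by
            rw [← add_mul]; congr 1; omega
        _ ≤ n := by simp only [hc]; omega
    exact_mod_cast this
  have hout : ((K : ℝ) + 3) * (c 0 + c (K + 3)) ≤ n := by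
    have h1 := (hle 0).2
    have h2 := (hle (K + 3)).1
    have : (K + 3) * (c 0 + c (K + 3)) ≤ n := by
      rw [mul_add]; simp only [hc]; rw [show K + 4 - 1 - 0 = K + 3 by omega] at h1; omega
    exact_mod_cast this
  have hin : ((K : ℝ) + 2) * (c 1 + c (K + 2)) ≤ n := by
    have h1 := (hle 1).2
    have h2 := (hle (K + 2)).1
    have : (K + 2) * (c 1 + c (K + 2)) ≤ n := by
      rw [mul_add]; simp only [hc]
      rw [show K + 4 - 1 - 1 = K + 2 by omega] at h1; omega
    exact_mod_cast this
  have hsum : ∑ i ∈ Finset.range (K + 4), c i =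
      ∑ i ∈ Finset.range K, c (i + 2) + (c 0 + c (K + 3)) + (c 1 + c (K + 2)) := by
    rw [Finset.sum_range_succ, Finset.sum_range_succ, Finset.sum_range_succ',
      Finset.sum_range_succ']
    ring
  have hK : (1 : ℝ) ≤ K := by exact_mod_cast (by omega : 1 ≤ K)
  have hmid' : (∑ i ∈ Finset.range K, (c (i + 2) : ℝ)) ≤ K * (n / (K + 3)) := by
    refine (Finset.sum_le_card_nsmul _ _ (n / (K + 3) : ℝ) fun i hi => ?_).trans (by simp)
    rw [le_div_iff₀ (by positivity)]
    linarith [hmid i (Finset.mem_range.1 hi)]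
  have hout' : (c 0 + c (K + 3) : ℝ) ≤ n / (K + 3) := by
    rw [le_div_iff₀ (by positivity)]; linarith
  have hin' : (c 1 + c (K + 2) : ℝ) ≤ n / (K + 2) := by
    rw [le_div_iff₀ (by positivity)]; linarith
  have hfrac : (K : ℝ) / (K + 3) + 1 / (K + 3) + 1 / (K + 2) ≤ 1 - 1 / (2 * (K + 4)) := by
    rw [div_add_div _ _ (by positivity) (by positivity), div_add_div _ _ (by positivity)
      (by positivity), one_sub_div (by positivity), div_le_div_iff₀ (by positivity) (by positivity)]
    have hK0 : (0 : ℝ) ≤ K - 1 := by linarith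
    obtain ⟨z, hz⟩ : ∃ z : ℝ, z = K - 1 := ⟨_, rfl⟩
    have : (K : ℝ) = z + 1 := by linarith
    rw [← hz] at hK0
    rw [this]
    have : 0 ≤ z ^ 2 ∧ 0 ≤ z ^ 3 ∧ 0 ≤ z ^ 4 := ⟨by positivity, by positivity, by positivity⟩
    nlinarith [this.1, this.2.1, this.2.2]
  rw [hsum]
  push_cast
  calc _ ≤ K * ((n : ℝ) / (K + 3)) + n / (K + 3) + n / (K + 2) := by linarith
    _ = n * ((K : ℝ) / (K + 3) + 1 / (K + 3) + 1 / (K + 2)) := by ring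
    _ ≤ _ := mul_le_mul_of_nonneg_left hfrac (Nat.cast_nonneg _)

open Classical in
/-- The `k`-term progressions of `[n]` that contain `x`. -/
def progressionsThrough (k n x : ℕ) : Finset (ℕ ×ₗ ℕ) :=
  (progressions k n).filter fun e => ∃ i < k, (ofLex e).1 + i * (ofLex e).2 = x

theorem card_progressionsThrough_le {k : ℕ} (hk : 5 ≤ k) (n x : ℕ) :
    ((progressionsThrough k n x).card : ℝ) ≤ n * (1 - 1 / (2 * k)) := by
  classical
  have hk' : (5 : ℝ) ≤ k := by exact_mod_cast hk
  have hpos : (0 : ℝ) ≤ 1 - 1 / (2 * k) := by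
    rw [sub_nonneg, div_le_one (by positivity)]; linarith
  have hsub : progressionsThrough k n x ⊆ (Finset.range k).biUnion fun i =>
      (differences k n x i).image fun d => toLex (x - i * d, d) := by
    intro e he
    obtain ⟨hp, i, hi, hx⟩ := Finset.mem_filter.1 he
    obtain ⟨⟨a, d⟩, rfl⟩ := toLex.surjective e
    obtain ⟨ha, hd, hn⟩ := (mem_progressions (by omega)).1 hp
    simp only [ofLex_toLex] at hx
    have hsplit : (k - 1) * d = i * d + (k - 1 - i) * d := by
      rw [← add_mul]; congr 1; omega
    have hdn : d ≤ (k - 1) * d := Nat.le_mul_of_pos_left d (by omega)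
    simp only [Finset.mem_biUnion, Finset.mem_image, Finset.mem_range, differences,
      Finset.mem_filter, Finset.mem_Icc]
    refine ⟨i, hi, d, ⟨⟨hd, by omega⟩, by omega, by omega⟩, ?_⟩
    rw [← hx, Nat.add_sub_cancel]
  -- A progression through `x` certifies `1 ≤ x ≤ n`; for other `x` there is nothing to count.
  rcases (progressionsThrough k n x).eq_empty_or_nonempty with h | ⟨e, he⟩
  · rw [h]; simpa using mul_nonneg (Nat.cast_nonneg n) hpos
  obtain ⟨hp, i, hi, hx⟩ := Finset.mem_filter.1 he
  obtain ⟨⟨a, d⟩, rfl⟩ := toLex.surjective e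
  obtain ⟨ha, hd, hn⟩ := (mem_progressions (by omega)).1 hp
  simp only [ofLex_toLex] at hx
  have hid : i * d ≤ (k - 1) * d := Nat.mul_le_mul_right _ (by omega)
  refine le_trans ?_ (sum_card_differences_le hk (x := x) (n := n) (by omega) (by omega))
  exact_mod_cast (Finset.card_le_card hsub).trans
    (Finset.card_biUnion_le.trans (Finset.sum_le_sum fun i _ => Finset.card_image_le))

theorem card_neighbors_le {k : ℕ} (hk : 5 ≤ k) (n : ℕ) (e : ℕ ×ₗ ℕ) :
    ((neighbors k n e).card : ℝ) ≤ n * (k - 1 / 2) := by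
  classical
  have hk' : (5 : ℝ) ≤ k := by exact_mod_cast hk
  have hsub : neighbors k n e ⊆ (Finset.range k).biUnion fun j =>
      progressionsThrough k n ((ofLex e).1 + j * (ofLex e).2) := by
    intro e' he'
    obtain ⟨hp, i, hi, j, hj, h⟩ := Finset.mem_filter.1 he'
    exact Finset.mem_biUnion.2 ⟨j, Finset.mem_range.2 hj, Finset.mem_filter.2 ⟨hp, i, hi, h⟩⟩
  calc ((neighbors k n e).card : ℝ)
      ≤ ∑ j ∈ Finset.range k,
          ((progressionsThrough k n ((ofLex e).1 + j * (ofLex e).2)).card : ℝ) := by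
        exact_mod_cast (Finset.card_le_card hsub).trans Finset.card_biUnion_le
    _ ≤ k * (n * (1 - 1 / (2 * k))) := by
        refine (Finset.sum_le_card_nsmul _ _ _ fun j _ =>
          card_progressionsThrough_le hk n _).trans (by simp)
    _ = n * (k - 1 / 2) := by field_simp

/-! ### The failure probability -/

/-- For `n` at most `2^(k-1) / (e k)`, the recoloring process goes on for `2 k (n + 2)` rounds
with probability at most `1/3`. -/
theorem coins_chain_le_third {k n : ℕ} (hk : 5 ≤ k) (hn : (n : ℝ) ≤ nPrime k) :
    coins {ω | ∃ w b c', w.length = 2 * k * (n + 2) ∧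
      Chain k n ω (fun x => ω (x - 1)) n w b c'} ≤ 1 / 3 := by
  have hk' : (5 : ℝ) ≤ k := by exact_mod_cast hk
  -- For `n = 0` the number `Δ` below would vanish, but then no round can take place.
  rcases Nat.eq_zero_or_pos n with rfl | hn0
  · rw [show {ω | _} = (∅ : Set (ℕ → Bool)) from ?_, MeasureTheory.measure_empty]
    · exact zero_le
    refine Set.eq_empty_of_forall_notMem ?_
    rintro ω ⟨w, b, c', hw, h⟩
    cases h with
    | nil => simp at hw; omega
    | cons hl _ => have := hl.1.1; unfold IsAP at this; omega
  have hn0' : (1 : ℝ) ≤ n := by exact_mod_cast hn0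
  set m := 2 * k * (n + 2) with hm
  set Δ : ℝ := n * (k - 1 / 2) with hΔ
  have hΔpos : 0 < Δ := by apply mul_pos <;> linarith
  -- With `y = 1/Δ` the product `B y` is Euler's number, which bounds `(1 + 1/Δ)^Δ`.
  have hwords := card_words_le (Γ := neighbors k n) (y := 1 / Δ) (B := Real.exp 1 * Δ)
    (by positivity) (by positivity) (fun e => by
      have h1 : (1 + 1 / Δ) ^ (neighbors k n e).card ≤
          Real.exp (1 / Δ) ^ (neighbors k n e).card :=
        pow_le_pow_left₀ (by positivity) (by linarith [Real.add_one_le_exp (1 / Δ)]) _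
      refine h1.trans ?_
      rw [← Real.exp_nat_mul, mul_assoc, mul_one_div_cancel hΔpos.ne', mul_one]
      refine Real.exp_le_exp.2 ?_
      rw [mul_one_div, div_le_one hΔpos]
      exact card_neighbors_le hk n e) m (progressions k n)
  have hU : (1 + 1 / Δ) ^ (progressions k n).card ≤ Real.exp n := by
    calc (1 + 1 / Δ) ^ (progressions k n).card
        ≤ (1 + 1 / Δ) ^ (n * n) :=
          pow_le_pow_right₀ (by linarith [one_div_pos.2 hΔpos]) (card_progressions_le k n)
      _ ≤ Real.exp (1 / Δ) ^ (n * n) :=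
          pow_le_pow_left₀ (by positivity) (by linarith [Real.add_one_le_exp (1 / Δ)]) _
      _ ≤ Real.exp n := by
          rw [← Real.exp_nat_mul]
          refine Real.exp_le_exp.2 ?_
          rw [mul_one_div, div_le_iff₀ hΔpos, hΔ]
          push_cast
          have : (n : ℝ) * 1 ≤ n * (k - 1 / 2) := by
            apply mul_le_mul_of_nonneg_left <;> linarith
          nlinarith
  -- The half in `Δ = n (k - 1/2)` becomes the decay `1 - 1/(2k)` per round; with `n k` the rate
  -- could be `1`.
  have hrate : Real.exp 1 * Δ * 2⁻¹ ^ (k - 1) ≤ 1 - 1 / (2 * k) := by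
    have h2 : (0 : ℝ) < 2 ^ (k - 1) := by positivity
    have : Real.exp 1 * k * n ≤ 2 ^ (k - 1) := by
      rw [nPrime, le_div_iff₀ (by positivity)] at hn
      linarith
    rw [inv_pow, ← div_eq_mul_inv, div_le_iff₀ h2]
    calc Real.exp 1 * Δ = (1 - 1 / (2 * k)) * (Real.exp 1 * k * n) := by
          rw [hΔ]; field_simp
      _ ≤ _ := by
          refine mul_le_mul_of_nonneg_left this ?_
          rw [sub_nonneg, div_le_one (by positivity)]; linarith
  have hreal : ((words (neighbors k n) m (progressions k n)).card : ℝ) * (2⁻¹ ^ (k - 1)) ^ m ≤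
      1 / 3 := by
    calc _ ≤ (Real.exp 1 * Δ) ^ m * Real.exp n * (2⁻¹ ^ (k - 1)) ^ m := by
          refine mul_le_mul_of_nonneg_right (hwords.trans ?_) (by positivity)
          exact mul_le_mul_of_nonneg_left hU (by positivity)
      _ = (Real.exp 1 * Δ * 2⁻¹ ^ (k - 1)) ^ m * Real.exp n := by
          rw [mul_pow (Real.exp 1 * Δ)]; ring
      _ ≤ Real.exp (-(1 / (2 * k))) ^ m * Real.exp n := by
          refine mul_le_mul_of_nonneg_right (pow_le_pow_left₀ (by positivity) ?_ _)
            (Real.exp_pos _).le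
          exact hrate.trans (by linarith [Real.add_one_le_exp (-(1 / (2 * (k : ℝ))))])
      -- The length `m = 2 k (n + 2)` gives decay `exp(-(n + 2))`, which beats the factor `exp n`
      -- from the initial candidates by `exp(-2)`.
      _ = Real.exp (-2) := by
          rw [← Real.exp_nat_mul, ← Real.exp_add, hm]
          congr 1
          push_cast
          field_simp
          ring
      _ ≤ 1 / 3 := by
          rw [Real.exp_neg, one_div]
          refine inv_anti₀ (by norm_num) ?_
          linarith [Real.add_one_le_exp (2 : ℝ)]
  refine (coins_chain_le (by omega) n m).trans ?_
  have hsplit : ((2 : ENNReal) ^ m * 2 ^ n) * 2⁻¹ ^ (n + k * m) = (2⁻¹ ^ (k - 1)) ^ m := by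
    have h2 : (2 : ENNReal) * 2⁻¹ = 1 := ENNReal.mul_inv_cancel (by norm_num) (by norm_num)
    have : n + k * m = m + n + (k - 1) * m := by
      obtain ⟨K, rfl⟩ : ∃ K, k = K + 1 := ⟨k - 1, by omega⟩
      simp only [Nat.add_sub_cancel]; ring
    rw [this, pow_add, ← pow_add, ← mul_assoc, ← mul_pow, h2, one_pow, one_mul, pow_mul]
  rw [mul_assoc, hsplit]
  have := ENNReal.ofReal_le_ofReal hreal
  rw [ENNReal.ofReal_mul (by positivity), ENNReal.ofReal_natCast, ENNReal.ofReal_pow (by positivity),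
    ENNReal.ofReal_pow (by positivity), ENNReal.ofReal_inv_of_pos (by norm_num),
    ENNReal.ofReal_ofNat, ENNReal.ofReal_div_of_pos (by norm_num), ENNReal.ofReal_one,
    ENNReal.ofReal_ofNat] at this
  exact this

/-! ### The parameters -/

/-- The integer `k! * ∑ i ≤ k, 1 / i!`. -/
def expNumerator (k : ℕ) : ℕ :=
  ∑ j ∈ Finset.range (k + 1), k.descFactorial j

/-- The length of the interval to be colored. -/
def size (k : ℕ) : ℕ :=
  2 ^ (k - 1) * k.factorial / (k * expNumerator k) - 1

/-- The number of times that a number may be recolored. -/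
def threshold (k : ℕ) : ℕ :=
  2 * k * (size k + 2)

theorem expNumerator_eq (k : ℕ) :
    (expNumerator k : ℝ) = k.factorial * ∑ i ∈ Finset.range (k + 1), 1 / (i.factorial : ℝ) := by
  rw [expNumerator, ← Finset.sum_range_reflect, Finset.mul_sum]
  push_cast
  refine Finset.sum_congr rfl fun i hi => ?_
  have hi' : i ≤ k := Nat.lt_succ_iff.1 (Finset.mem_range.1 hi)
  have h := Nat.factorial_mul_descFactorial (n := k) (k := k - i) (by omega)
  rw [Nat.sub_sub_self hi'] at h
  have h' : (i.factorial : ℝ) * k.descFactorial (k - i) = k.factorial := by exact_mod_cast h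
  rw [mul_one_div,
    eq_div_iff (by exact_mod_cast i.factorial_ne_zero), mul_comm, h']

theorem expNumerator_pos (k : ℕ) : 0 < expNumerator k := by
  refine Finset.sum_pos' (fun _ _ => Nat.zero_le _) ⟨0, by simp, by simp⟩

theorem nPrime_pos {k : ℕ} (hk : 1 ≤ k) : 0 < nPrime k := by
  have : (0 : ℝ) < k := by exact_mod_cast hk
  unfold nPrime
  positivity

theorem two_pow_pred_le_factorial (k : ℕ) : 2 ^ (k - 1) ≤ k.factorial := by
  rcases k with _ | k
  · simp
  · simpa [add_comm] using Nat.factorial_mul_pow_le_factorial (m := 1) (n := k)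

/-- The quotient that the program computes is an upper approximation of `2^(k-1) / (e k)`. -/
theorem quotient_bounds {k : ℕ} (hk : 1 ≤ k) :
    nPrime k ≤ ((2 ^ (k - 1) * k.factorial : ℕ) : ℝ) / (k * expNumerator k : ℕ) ∧
      ((2 ^ (k - 1) * k.factorial : ℕ) : ℝ) / (k * expNumerator k : ℕ) ≤ nPrime k + 1 / 4 := by
  have hk' : (1 : ℝ) ≤ k := by exact_mod_cast hk
  set s : ℝ := ∑ i ∈ Finset.range (k + 1), 1 / (i.factorial : ℝ) with hs
  have hfac : (0 : ℝ) < k.factorial := by exact_mod_cast k.factorial_pos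
  have hr : ((2 ^ (k - 1) * k.factorial : ℕ) : ℝ) / (k * expNumerator k : ℕ) =
      2 ^ (k - 1) / (k * s) := by
    push_cast
    rw [expNumerator_eq, ← hs]
    by_cases h : s = 0
    · simp [h]
    · field_simp
  have hs2 : 2 ≤ s := by
    calc (2 : ℝ) = ∑ i ∈ Finset.range 2, 1 / (i.factorial : ℝ) := by
          norm_num [Finset.sum_range_succ]
      _ ≤ s := by
          refine Finset.sum_le_sum_of_subset_of_nonneg
            (Finset.range_subset_range.2 (by omega)) fun _ _ _ => by positivity
  have hse : s ≤ Real.exp 1 := by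
    simpa [hs] using Real.sum_le_exp_of_nonneg (zero_le_one) (k + 1)
  have hes : Real.exp 1 - s ≤ (k + 2) / ((k + 1) * k.factorial * (k + 1)) := by
    have := Real.exp_bound (x := 1) (by simp) (n := k + 1) (by omega)
    simp only [one_pow, abs_one, one_mul, Nat.factorial_succ] at this
    push_cast at this
    have h := (le_abs_self _).trans this
    rw [show (k : ℝ) + 1 + 1 = k + 2 by ring] at h
    exact h
  have hpow : (2 : ℝ) ^ (k - 1) ≤ k.factorial := by
    exact_mod_cast two_pow_pred_le_factorial k
  have he := Real.exp_pos 1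
  rw [hr]
  unfold nPrime
  refine ⟨div_le_div_of_nonneg_left (by positivity) (by positivity) ?_, ?_⟩
  · rw [mul_comm (k : ℝ)]
    exact mul_le_mul_of_nonneg_right hse (by positivity)
  · have hdiff : (2 : ℝ) ^ (k - 1) / (k * s) - 2 ^ (k - 1) / (Real.exp 1 * k) =
        2 ^ (k - 1) * (Real.exp 1 - s) / (k * (Real.exp 1 * s)) := by
      field_simp
    -- The tail of the exponential series is of order `1/(k+1)!`, so stopping at `1/k!` outweighs
    -- the factor `2^(k-1) ≤ k!`.
    have hnum : (2 : ℝ) ^ (k - 1) * (Real.exp 1 - s) ≤ 1 := by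
      calc (2 : ℝ) ^ (k - 1) * (Real.exp 1 - s)
          ≤ k.factorial * ((k + 2) / ((k + 1) * k.factorial * (k + 1))) :=
            mul_le_mul hpow hes (by linarith) hfac.le
        _ = (k + 2) / ((k + 1) * (k + 1)) := by field_simp
        _ ≤ 1 := by rw [div_le_one (by positivity)]; nlinarith
    have : 2 ^ (k - 1) * (Real.exp 1 - s) / (k * (Real.exp 1 * s)) ≤ 1 / 4 := by
      rw [div_le_div_iff₀ (by positivity) (by norm_num)]
      have h4 : 4 ≤ Real.exp 1 * s := by nlinarith
      nlinarith
    linarith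

theorem size_of_le_four {k : ℕ} (hk : 1 ≤ k) (hk4 : k ≤ 4) : size k = 0 := by
  interval_cases k <;> decide

theorem nPrime_lt_one {k : ℕ} (hk : 1 ≤ k) (hk4 : k ≤ 4) : nPrime k < 1 := by
  have he : 2 < Real.exp 1 := by linarith [Real.exp_one_gt_d9]
  have hk' : (0 : ℝ) < k := by exact_mod_cast hk
  rw [nPrime, div_lt_one (by positivity)]
  have : (2 : ℝ) ^ (k - 1) ≤ 2 * k := by interval_cases k <;> norm_num
  nlinarith

theorem le_nPrime {k : ℕ} (hk : 5 ≤ k) : 1.15 ≤ nPrime k := by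
  have he : Real.exp 1 < 2.7182818286 := Real.exp_one_lt_d9
  have hk' : (5 : ℝ) ≤ k := by exact_mod_cast hk
  rw [nPrime, le_div_iff₀ (by positivity)]
  have : 16 * k ≤ 5 * 2 ^ (k - 1) := by
    induction k, hk using Nat.le_induction with
    | base => simp
    | succ n hn ih =>
      rw [Nat.add_sub_cancel, show n = n - 1 + 1 by omega, pow_succ]
      have := ih (by exact_mod_cast hn)
      omega
  have : (16 : ℝ) * k ≤ 5 * 2 ^ (k - 1) := by exact_mod_cast this
  nlinarith

theorem one_third_le_nPrime {k : ℕ} (hk : 1 ≤ k) : 1 / 3 ≤ nPrime k := by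
  have he : Real.exp 1 < 2.7182818286 := Real.exp_one_lt_d9
  have hk' : (1 : ℝ) ≤ k := by exact_mod_cast hk
  rw [nPrime, le_div_iff₀ (by positivity)]
  have : k ≤ 2 ^ (k - 1) := by have := Nat.lt_two_pow_self (n := k - 1); omega
  have : (k : ℝ) ≤ 2 ^ (k - 1) := by exact_mod_cast this
  nlinarith

/-- Needed to bound the running time in terms of `n'` alone: `k^2 ≤ 3 * 2^(k-1)` and `3 e < 9`. -/
theorem le_nine_mul_nPrime {k : ℕ} (hk : 1 ≤ k) : (k : ℝ) ≤ 9 * nPrime k := by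
  have he : Real.exp 1 < 2.7182818286 := Real.exp_one_lt_d9
  have hk' : (1 : ℝ) ≤ k := by exact_mod_cast hk
  rw [nPrime, mul_div_assoc', le_div_iff₀ (by positivity)]
  have : k * k ≤ 3 * 2 ^ (k - 1) := by
    rcases le_or_gt k 4 with h | h
    · interval_cases k <;> norm_num
    · induction k, (show 5 ≤ k from h) using Nat.le_induction with
      | base => norm_num
      | succ n hn ih =>
        rw [Nat.add_sub_cancel, show n = n - 1 + 1 by omega, pow_succ]
        have := ih (by omega) (by exact_mod_cast (by omega : 1 ≤ n)) (by omega)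
        rw [show n - 1 + 1 = n by omega]
        nlinarith
  have : (k : ℝ) * k ≤ 3 * 2 ^ (k - 1) := by exact_mod_cast this
  nlinarith

theorem nPrime_lt_size_add_two {k : ℕ} (hk : 1 ≤ k) : nPrime k < size k + 2 := by
  have hD : 0 < k * expNumerator k := Nat.mul_pos hk (expNumerator_pos k)
  have h1 := Nat.lt_floor_add_one
    (((2 ^ (k - 1) * k.factorial : ℕ) : ℝ) / (k * expNumerator k : ℕ))
  rw [Nat.floor_div_eq_div] at h1
  have h2 : 2 ^ (k - 1) * k.factorial / (k * expNumerator k) + 1 ≤ size k + 2 := by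
    unfold size; omega
  have h3 : ((2 ^ (k - 1) * k.factorial / (k * expNumerator k) : ℕ) : ℝ) + 1 ≤ size k + 2 := by
    exact_mod_cast h2
  linarith [(quotient_bounds hk).1]

/-- The quotient exceeds `n'` by at most `1/4` and is lowered by `1`. The remaining gap `3/4` is
what forces `ε` to be at least of order `1/(n' k)`. -/
theorem size_eq_zero_or_le (k : ℕ) : size k = 0 ∨ (size k : ℝ) ≤ nPrime k - 3 / 4 := by
  rcases Nat.eq_zero_or_pos k with rfl | hk
  · left; simp [size]
  rcases Nat.eq_zero_or_pos (size k) with h | h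
  · exact Or.inl h
  refine Or.inr ?_
  have h1 := Nat.floor_le (a := ((2 ^ (k - 1) * k.factorial : ℕ) : ℝ) / (k * expNumerator k : ℕ))
    (by positivity)
  rw [Nat.floor_div_eq_div] at h1
  have h2 : size k + 1 ≤ 2 ^ (k - 1) * k.factorial / (k * expNumerator k) := by
    unfold size at h ⊢; omega
  have h3 : (size k : ℝ) + 1 ≤ (2 ^ (k - 1) * k.factorial / (k * expNumerator k) : ℕ) := by
    exact_mod_cast h2
  linarith [(quotient_bounds hk).2]

theorem size_le_nPrime {k : ℕ} (hk : 1 ≤ k) : (size k : ℝ) ≤ nPrime k := by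
  rcases size_eq_zero_or_le k with h | h
  · rw [h]; exact_mod_cast (nPrime_pos hk).le
  · linarith

theorem two_rpow_div {k : ℕ} (hk : 1 ≤ k) (ε : ℝ) :
    (2 : ℝ) ^ (((k : ℝ) - 1) * (1 - ε)) / (Real.exp 1 * k) =
      nPrime k * Real.exp (-(((k : ℝ) - 1) * ε * Real.log 2)) := by
  have h : ((k : ℝ) - 1) * (1 - ε) = ((k - 1 : ℕ) : ℝ) + -(((k : ℝ) - 1) * ε) := by
    rw [Nat.cast_sub hk]; push_cast; ring
  rw [h, Real.rpow_add (by norm_num), Real.rpow_natCast, Real.rpow_def_of_pos (by norm_num),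
    nPrime]
  ring_nf

/-- For `k ≥ 5` the exponent is chosen so that `2^((k-1)(1-ε))/(e k)` equals `v = max (size k) (n' -
1)`. This `v` has floor `size k` and lies between `n' - 1` and `n' - 3/4`, so `ε = log(n'/v) /
((k-1) log 2)` has order `1/(n' k)`. For `k ≤ 4`, where `n' < 1` and `size k = 0`, the equation need
not be solved and `ε = 1/(n' k)` works. -/
theorem exists_exponent {k : ℕ} (hk : 1 ≤ k) :
    ∃ ε : ℝ, 1 / 2 / (nPrime k * k) ≤ ε ∧ ε ≤ 20 / (nPrime k * k) ∧
      nPrime k - 1 ≤ (2 : ℝ) ^ (((k : ℝ) - 1) * (1 - ε)) / (Real.exp 1 * k) ∧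
      size k = ⌊(2 : ℝ) ^ (((k : ℝ) - 1) * (1 - ε)) / (Real.exp 1 * k)⌋₊ := by
  have hpos := nPrime_pos hk
  have hk' : (1 : ℝ) ≤ k := by exact_mod_cast hk
  rcases le_or_gt k 4 with hk4 | hk5
  · refine ⟨1 / (nPrime k * k), ?_, ?_, ?_⟩
    · gcongr; norm_num
    · gcongr; norm_num
    have h1 := nPrime_lt_one hk hk4
    rw [two_rpow_div hk, size_of_le_four hk hk4]
    refine ⟨by have : 0 ≤ nPrime k * Real.exp (-(((k : ℝ) - 1) * (1 / (nPrime k * k)) *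
      Real.log 2)) := by positivity
               linarith, ?_⟩
    rw [eq_comm, Nat.floor_eq_zero]
    have : Real.exp (-(((k : ℝ) - 1) * (1 / (nPrime k * k)) * Real.log 2)) ≤ 1 := by
      rw [Real.exp_le_one_iff, neg_nonpos]
      have := Real.log_nonneg (x := 2) (by norm_num)
      have : 0 ≤ (k : ℝ) - 1 := by linarith
      positivity
    nlinarith
  · have h5 : (5 : ℝ) ≤ k := by exact_mod_cast hk5
    have hn := le_nPrime hk5
    set v : ℝ := max (size k) (nPrime k - 1) with hv
    have hv1 : nPrime k - 1 ≤ v := le_max_right _ _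
    have hv2 : v ≤ nPrime k - 3 / 4 := by
      refine max_le ?_ (by linarith)
      rcases size_eq_zero_or_le k with h | h
      · rw [h]; norm_num at hn ⊢; linarith
      · exact h
    have hvpos : 0 < v := by norm_num at hn; linarith
    have hfloor : size k = ⌊v⌋₊ := by
      rw [eq_comm, Nat.floor_eq_iff hvpos.le]
      exact ⟨le_max_left _ _, max_lt (by linarith) (by linarith [nPrime_lt_size_add_two hk])⟩
    have hl1 : Real.log 2 < 0.6931471808 := Real.log_two_lt_d9
    have hl2 : 0.6931471803 < Real.log 2 := Real.log_two_gt_d9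
    have hlog2 : 0 < Real.log 2 := by norm_num at hl2; linarith
    have hk1 : 0 < (k : ℝ) - 1 := by linarith
    set l := Real.log (nPrime k / v) with hl
    have hlower : 3 / 4 / nPrime k ≤ l := by
      have := Real.one_sub_inv_le_log_of_pos (x := nPrime k / v) (by positivity)
      refine le_trans ?_ this
      rw [inv_div, one_sub_div hpos.ne']
      gcongr
      linarith
    -- From `log x ≤ x - 1` and `n' - v ≤ 1` one gets `l ≤ 1/v`; moreover `n' ≤ 10 v`, because `n' ≥
    -- 1.15 > 10/9`.
    have hupper : l ≤ 10 / nPrime k := by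
      have := Real.log_le_sub_one_of_pos (x := nPrime k / v) (by positivity)
      refine this.trans ?_
      rw [div_sub_one hvpos.ne', div_le_div_iff₀ hvpos hpos]
      norm_num at hn
      nlinarith
    refine ⟨l / ((k - 1) * Real.log 2), ?_, ?_, ?_⟩
    · rw [le_div_iff₀ (by positivity)]
      refine le_trans ?_ hlower
      rw [div_mul_eq_mul_div, div_le_div_iff₀ (by positivity) hpos]
      have : ((k : ℝ) - 1) * Real.log 2 ≤ k := by norm_num at hl1; nlinarith
      nlinarith [mul_le_mul_of_nonneg_left this hpos.le, mul_pos hpos (by linarith : (0 : ℝ) < k)]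
    · rw [div_le_iff₀ (by positivity)]
      refine hupper.trans ?_
      rw [div_mul_eq_mul_div, div_le_div_iff₀ hpos (by positivity)]
      have : (k : ℝ) ≤ 2 * (((k : ℝ) - 1) * Real.log 2) := by norm_num at hl2; nlinarith
      nlinarith [mul_le_mul_of_nonneg_left this hpos.le]
    · have hval : nPrime k * Real.exp (-(((k : ℝ) - 1) * (l / ((k - 1) * Real.log 2)) *
          Real.log 2)) = v := by
        have : ((k : ℝ) - 1) * (l / ((k - 1) * Real.log 2)) * Real.log 2 = l := by field_simp
        rw [this, hl, Real.exp_neg, Real.exp_log (by positivity)]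
        field_simp
      rw [two_rpow_div hk, hval]
      exact ⟨hv1, hfloor⟩

/-- With `z = n' k` the threshold is at most `14 z` and `z/20 ≤ 1/ε`, so exponent `1` would do.
Passing to `1.01` uses `z/20 ≥ 1/60` to bound the extra power below by `1/60`; thus `16800 = 14 * 20
* 60`. -/
theorem threshold_le {k : ℕ} (hk : 1 ≤ k) {ε : ℝ} (hε0 : 0 < ε)
    (hε : ε ≤ 20 / (nPrime k * k)) : (threshold k : ℝ) ≤ 16800 * ε ^ (-(1.01 : ℝ)) := by
  have hk' : (1 : ℝ) ≤ k := by exact_mod_cast hk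
  have h3 := one_third_le_nPrime hk
  have hpos := nPrime_pos hk
  set z := nPrime k * k with hz
  have hzpos : 0 < z := by positivity
  have hz3 : 1 / 3 ≤ z := by nlinarith
  have h1 : z / 20 ≤ ε⁻¹ := by
    rw [← inv_div]
    exact inv_anti₀ hε0 hε
  have h2 : 1 / 60 * (z / 20) ≤ ε ^ (-(1.01 : ℝ)) := by
    rw [Real.rpow_neg hε0.le, ← Real.inv_rpow hε0.le]
    calc 1 / 60 * (z / 20) ≤ (1 / 60) ^ (0.01 : ℝ) * (z / 20) := by
          refine mul_le_mul_of_nonneg_right ?_ (by positivity)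
          calc (1 / 60 : ℝ) = (1 / 60) ^ (1 : ℝ) := (Real.rpow_one _).symm
            _ ≤ _ := Real.rpow_le_rpow_of_exponent_ge (by norm_num) (by norm_num) (by norm_num)
      _ ≤ (z / 20) ^ (0.01 : ℝ) * (z / 20) := by
          refine mul_le_mul_of_nonneg_right ?_ (by positivity)
          exact Real.rpow_le_rpow (by norm_num) (by linarith) (by norm_num)
      _ = (z / 20) ^ (1.01 : ℝ) := by
          rw [← Real.rpow_add_one (by positivity)]; norm_num
      _ ≤ (ε⁻¹) ^ (1.01 : ℝ) := Real.rpow_le_rpow (by positivity) h1 (by norm_num)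
  have h4 : (threshold k : ℝ) ≤ 14 * z := by
    have := size_le_nPrime hk
    unfold threshold
    push_cast
    nlinarith
  linarith

theorem floor_le_size {k : ℕ} (hk : 1 ≤ k) : ⌊nPrime k - 1⌋₊ ≤ size k := by
  have := nPrime_lt_size_add_two hk
  rcases le_or_gt 0 (nPrime k - 1) with h | h
  · exact Nat.lt_succ_iff.1 ((Nat.floor_lt h).2 (by push_cast; linarith))
  · rw [Nat.floor_of_nonpos h.le]; exact Nat.zero_le _

/-! ### Finiteness of the van der Waerden numbers -/

/-- Van der Waerden's theorem from Hales–Jewett: the map sending `v` to `1 + ∑ v j` takes a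
combinatorial line to a progression whose difference is the number of active coordinates. -/
theorem exists_not_proper (k c : ℕ) (hk : 1 ≤ k) : ∃ W, ¬ ∃ col : ℕ → ℕ, IsProper k c W col := by
  obtain ⟨ι, _, hι⟩ := Combinatorics.Line.exists_mono_in_high_dimension (Fin k) (Fin c)
  refine ⟨1 + Fintype.card ι * (k - 1), ?_⟩
  rintro ⟨col, hcol, hap⟩
  have hsum : ∀ v : ι → Fin k, ∑ j, (v j : ℕ) ≤ Fintype.card ι * (k - 1) := fun v =>
    (Finset.sum_le_card_nsmul _ _ (k - 1) fun j _ => by have := (v j).2; omega).trans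
      (by simp [Finset.card_univ])
  obtain ⟨l, b, hl⟩ := hι fun v => ⟨col (1 + ∑ j, (v j : ℕ)), hcol _ (by omega)
    (by have := hsum v; omega)⟩
  classical
  set d := (Finset.univ.filter fun j => l.idxFun j = none).card with hd
  have hline : ∀ i : Fin k, ∑ j, (l i j : ℕ) = ∑ j, (l ⟨0, hk⟩ j : ℕ) + i * d := fun i => by
    have : ∀ j, (l i j : ℕ) = l ⟨0, hk⟩ j + if l.idxFun j = none then (i : ℕ) else 0 := fun j => by
      cases h : l.idxFun j <;> simp [h]
    rw [Finset.sum_congr rfl fun j _ => this j, Finset.sum_add_distrib, Finset.sum_ite]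
    simp [hd, mul_comm]
  have hdpos : 1 ≤ d := by
    obtain ⟨j, hj⟩ := l.proper
    exact Finset.card_pos.2 ⟨j, by simpa using hj⟩
  refine hap (1 + ∑ j, (l ⟨0, hk⟩ j : ℕ)) d ⟨by omega, hdpos, ?_⟩ fun i hi => ?_
  · have := hline ⟨k - 1, by omega⟩
    have := hsum (l ⟨k - 1, by omega⟩)
    simp only at *
    omega
  · have h1 := congrArg Fin.val (hl ⟨i, hi⟩)
    have h2 := congrArg Fin.val (hl ⟨0, hk⟩)
    simp only at h1 h2
    rw [hline ⟨i, hi⟩] at h1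
    rw [add_assoc, h1, h2]

/-- Finiteness is essential here, since the infimum of the empty set of naturals is `0`. -/
theorem lt_vdW {k c n : ℕ} (hk : 1 ≤ k) {col : ℕ → ℕ} (h : IsProper k c n col) : n < vdW k c := by
  have hmem := Nat.sInf_mem (exists_not_proper k c hk)
  by_contra! hle
  exact hmem ⟨col, fun x hx hxn => h.1 x hx (hxn.trans hle), fun a d hap =>
    h.2 a d ⟨hap.1, hap.2.1, hap.2.2.trans hle⟩⟩

/-! ### Symbolic execution -/

/-- Execute the programs of a nonempty list one after the other. -/
def Prog.block : List Prog → Prog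
  | [] => .const 13 0
  | [p] => p
  | p :: q :: l => .seq p (Prog.block (q :: l))

/-- With the tosses `ω`, the program `p` started in `s` halts in some state after some number of
steps, and these satisfy `Q`. -/
def Runs (ω : ℕ → Bool) (p : Prog) (s : State) (Q : State → ℕ → Prop) : Prop :=
  ∃ s' τ, Exec ω p s s' τ ∧ Q s' τ

/-- The state `s` with the value `v` written into memory cell `i`. -/
def State.setMem (s : State) (i v : ℕ) : State :=
  { s with mem := Function.update s.mem i v }

/-- The state `s` after one more coin was tossed. -/
def State.addToss (s : State) : State :=
  { s with tossed := s.tossed + 1 }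

section
variable {ω : ℕ → Bool} {s : State} {Q : State → ℕ → Prop} {p q : Prog} {i j l v : ℕ}

@[simp] theorem State.setReg_reg : (s.setReg i v).reg j = if j = i then v else s.reg j :=
  Function.update_apply _ _ _ _
@[simp] theorem State.setReg_mem : (s.setReg i v).mem = s.mem := rfl
@[simp] theorem State.setReg_tossed : (s.setReg i v).tossed = s.tossed := rfl
@[simp] theorem State.setMem_reg : (s.setMem i v).reg = s.reg := rfl
@[simp] theorem State.setMem_mem : (s.setMem i v).mem j = if j = i then v else s.mem j :=
  Function.update_apply _ _ _ _
@[simp] theorem State.setMem_tossed : (s.setMem i v).tossed = s.tossed := rfl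
@[simp] theorem State.addToss_reg : s.addToss.reg = s.reg := rfl
@[simp] theorem State.addToss_mem : s.addToss.mem = s.mem := rfl
@[simp] theorem State.addToss_tossed : s.addToss.tossed = s.tossed + 1 := rfl

theorem Runs.mono {Q' : State → ℕ → Prop} (h : Runs ω p s Q) (hQ : ∀ s' τ, Q s' τ → Q' s' τ) :
    Runs ω p s Q' := by
  obtain ⟨s', τ, he, hq⟩ := h
  exact ⟨s', τ, he, hQ _ _ hq⟩

@[simp] theorem runs_const : Runs ω (.const i v) s Q ↔ Q (s.setReg i v) 1 :=
  ⟨fun ⟨_, _, h, hq⟩ => by cases h; exact hq, fun h => ⟨_, _, .const .., h⟩⟩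

@[simp] theorem runs_add : Runs ω (.add i j l) s Q ↔ Q (s.setReg i (s.reg j + s.reg l)) 1 :=
  ⟨fun ⟨_, _, h, hq⟩ => by cases h; exact hq, fun h => ⟨_, _, .add .., h⟩⟩

@[simp] theorem runs_sub : Runs ω (.sub i j l) s Q ↔ Q (s.setReg i (s.reg j - s.reg l)) 1 :=
  ⟨fun ⟨_, _, h, hq⟩ => by cases h; exact hq, fun h => ⟨_, _, .sub .., h⟩⟩

@[simp] theorem runs_load : Runs ω (.load i j) s Q ↔ Q (s.setReg i (s.mem (s.reg j))) 1 :=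
  ⟨fun ⟨_, _, h, hq⟩ => by cases h; exact hq, fun h => ⟨_, _, .load .., h⟩⟩

@[simp] theorem runs_store : Runs ω (.store i j) s Q ↔ Q (s.setMem (s.reg i) (s.reg j)) 1 :=
  ⟨fun ⟨_, _, h, hq⟩ => by cases h; exact hq, fun h => ⟨_, _, .store .., h⟩⟩

@[simp] theorem runs_toss : Runs ω (.toss i) s Q ↔ Q (s.setReg i (ω s.tossed).toNat).addToss 1 :=
  ⟨fun ⟨_, _, h, hq⟩ => by cases h; exact hq, fun h => ⟨_, _, .toss .., h⟩⟩

@[simp] theorem runs_seq : Runs ω (.seq p q) s Q ↔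
    Runs ω p s fun s₁ τ₁ => Runs ω q s₁ fun s₂ τ₂ => Q s₂ (τ₁ + τ₂) :=
  ⟨fun ⟨_, _, h, hq⟩ => by cases h with | seq h₁ h₂ => exact ⟨_, _, h₁, _, _, h₂, hq⟩,
    fun ⟨_, _, h₁, _, _, h₂, hq⟩ => ⟨_, _, .seq h₁ h₂, hq⟩⟩

@[simp] theorem runs_branch : Runs ω (.branch i p q) s Q ↔
    (s.reg i ≠ 0 → Runs ω p s fun s' τ => Q s' (τ + 1)) ∧
      (s.reg i = 0 → Runs ω q s fun s' τ => Q s' (τ + 1)) := by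
  constructor
  · rintro ⟨s', τ, h, hq⟩
    cases h with
    | branch_pos h0 h => exact ⟨fun _ => ⟨_, _, h, hq⟩, fun h' => absurd h' h0⟩
    | branch_zero h0 h => exact ⟨fun h' => absurd h0 h', fun _ => ⟨_, _, h, hq⟩⟩
  · rintro ⟨h₁, h₂⟩
    by_cases h0 : s.reg i = 0
    · obtain ⟨_, _, h, hq⟩ := h₂ h0
      exact ⟨_, _, .branch_zero h0 h, hq⟩
    · obtain ⟨_, _, h, hq⟩ := h₁ h0
      exact ⟨_, _, .branch_pos h0 h, hq⟩

theorem runs_loop_zero (h : s.reg i = 0) (hQ : Q s 1) : Runs ω (.loop i p) s Q :=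
  ⟨_, _, .loop_zero h, hQ⟩

theorem runs_loop_pos (h : s.reg i ≠ 0) (hQ : Runs ω p s fun s₁ τ₁ =>
    Runs ω (.loop i p) s₁ fun s₂ τ₂ => Q s₂ (τ₁ + τ₂ + 1)) : Runs ω (.loop i p) s Q := by
  obtain ⟨_, _, h₁, _, _, h₂, hq⟩ := hQ
  exact ⟨_, _, .loop_pos h h₁ h₂, hq⟩

/-- The registers outside `r` have the same values in `s` and `s'`. -/
def SameRegs (r : List ℕ) (s s' : State) : Prop :=
  ∀ i, i ∉ r → s'.reg i = s.reg i

theorem SameRegs.trans {r : List ℕ} {s₁ s₂ s₃ : State} (h : SameRegs r s₁ s₂)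
    (h' : SameRegs r s₂ s₃) : SameRegs r s₁ s₃ := fun i hi => (h' i hi).trans (h i hi)

end

/-! ### Computing the parameters

Register `0` holds `k`, register `1` will hold the length of the interval and register `2` the
recoloring threshold. Registers `3` and `16` hold the constants `1` and `0`. -/

/-- `reg x := reg x + reg 7 * reg y` and `reg 7 := 0`. -/
def mulLoop (x y : ℕ) : Prog := .loop 7 (.block [.add x x y, .sub 7 7 3])

/-- A loop whose final state is known exactly gets a rule for an arbitrary postcondition, so that it
can be used like a single instruction. Loops with many scratch registers are instead described by
`SameRegs`. -/
theorem runs_mulLoop {ω : ℕ → Bool} {x y : ℕ} (hx : x ≠ 3) (hx' : x ≠ 7) (hy : y ≠ x)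
    (hy' : y ≠ 7) {s : State} (h3 : s.reg 3 = 1) {Q : State → ℕ → Prop}
    (hQ : Q ((s.setReg x (s.reg x + s.reg 7 * s.reg y)).setReg 7 0) (3 * s.reg 7 + 1)) :
    Runs ω (mulLoop x y) s Q := by
  generalize hm : s.reg 7 = m at hQ
  induction m generalizing s Q with
  | zero =>
    refine runs_loop_zero hm ?_
    convert hQ
    ext i <;> simp
    split_ifs with h1 h2
    · rw [h1, hm]
    · rw [h2]
    · rfl
  | succ m ih =>
    refine runs_loop_pos (by omega) ?_
    simp only [Prog.block, runs_seq, runs_add, runs_sub]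
    refine ih (by simp [h3, hx.symm]) (by simp [h3, hm, hx.symm, hx'.symm]) ?_
    convert hQ using 1
    · ext i <;> simp [hx', hy, hy']
      split_ifs <;> first | rfl | ring
    · ring

/-- `reg 4 := 2 ^ reg 7 * reg 4` and `reg 7 := 0`. -/
def doubleLoop : Prog := .loop 7 (.block [.add 4 4 4, .sub 7 7 3])

theorem runs_doubleLoop {ω : ℕ → Bool} {s : State} (h3 : s.reg 3 = 1) {Q : State → ℕ → Prop}
    (hQ : Q ((s.setReg 4 (2 ^ s.reg 7 * s.reg 4)).setReg 7 0) (3 * s.reg 7 + 1)) :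
    Runs ω doubleLoop s Q := by
  generalize hm : s.reg 7 = m at hQ
  induction m generalizing s Q with
  | zero =>
    refine runs_loop_zero hm ?_
    convert hQ
    ext i <;> simp
    split_ifs with h1 h2
    · rw [h1, hm]
    · rw [h2]
    · rfl
  | succ m ih =>
    refine runs_loop_pos (by omega) ?_
    simp only [Prog.block, runs_seq, runs_add, runs_sub]
    refine ih (by simp [h3]) (by simp [h3, hm]) ?_
    convert hQ using 1
    · ext i <;> simp
      split_ifs <;> first | rfl | ring
    · ring

/-- `reg 1 := reg 1 + reg 4 / reg 8`, where initially `reg 9 = reg 4 + 1 - reg 8`. -/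
def divLoop : Prog := .loop 9 (.block [.add 1 1 3, .sub 4 4 8, .add 9 4 3, .sub 9 9 8])

/-- By truncated subtraction register `9` is nonzero exactly when `reg 8 ≤ reg 4`, that is, when the
divisor can be subtracted once more. -/
theorem runs_divLoop {ω : ℕ → Bool} {s : State} (h3 : s.reg 3 = 1) (h8 : 0 < s.reg 8)
    (h9 : s.reg 9 = s.reg 4 + 1 - s.reg 8) :
    Runs ω divLoop s fun s' τ => s'.reg 1 = s.reg 1 + s.reg 4 / s.reg 8 ∧
      τ = 5 * (s.reg 4 / s.reg 8) + 1 ∧ SameRegs [1, 4, 9] s s' ∧ s'.mem = s.mem ∧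
      s'.tossed = s.tossed := by
  induction hm : s.reg 4 using Nat.strong_induction_on generalizing s with
  | _ m ih =>
  rcases lt_or_ge m (s.reg 8) with h | h
  · refine runs_loop_zero (by omega) ?_
    rw [Nat.div_eq_of_lt h]
    exact ⟨rfl, rfl, fun _ _ => rfl, rfl, rfl⟩
  · refine runs_loop_pos (by omega) ?_
    simp only [Prog.block, runs_seq, runs_add, runs_sub]
    refine (ih (m - s.reg 8) (by omega) (by simpa using h3) (by simpa using h8)
      (by simp [h3]) (by simp [hm])).mono ?_
    rintro s' τ ⟨h1, h2, h4, h5, h6⟩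
    have hdiv := Nat.div_eq_sub_div h8 h
    refine ⟨?_, ?_, fun i hi => (h4 i hi).trans ?_, h5, h6⟩
    · rw [h1]; simp [h3]; omega
    · rw [h2]; simp; omega
    · simp only [List.mem_cons, List.not_mem_nil, or_false, not_or] at hi
      simp [hi]

/-- `reg 4 := k!` and `reg 5 := k! * ∑ i ≤ k, 1 / i!`, where initially `reg 4 = reg 5 = 1` and
`reg 6 = k`. -/
def factorialLoop : Prog :=
  .loop 6 (.block [.const 8 0, .add 7 6 16, mulLoop 8 4, .add 4 8 16, .add 5 5 4, .sub 6 6 3])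

/-- After `j` rounds register `4` holds the falling factorial `k!/(k-j)!` and register `5` the sum
of those so far. The next factor `k - j` is the loop counter itself. -/
theorem runs_factorialLoop {ω : ℕ → Bool} {s : State} (h3 : s.reg 3 = 1) (h16 : s.reg 16 = 0)
    {k j : ℕ} (hjk : j ≤ k) (h6 : s.reg 6 = k - j) (h4 : s.reg 4 = k.descFactorial j)
    (h5 : s.reg 5 = ∑ i ∈ Finset.range (j + 1), k.descFactorial i) :
    Runs ω factorialLoop s fun s' τ => s'.reg 4 = k.factorial ∧ s'.reg 5 = expNumerator k ∧
      τ ≤ (3 * k + 7) * (k - j) + 1 ∧ SameRegs [4, 5, 6, 7, 8] s s' ∧ s'.mem = s.mem ∧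
      s'.tossed = s.tossed := by
  obtain ⟨m, hm⟩ : ∃ m, m = k - j := ⟨_, rfl⟩
  induction m generalizing s j with
  | zero =>
    obtain rfl : j = k := by omega
    exact runs_loop_zero (by omega) ⟨by rw [h4, Nat.descFactorial_self], h5, by simp,
      fun _ _ => rfl, rfl, rfl⟩
  | succ m ih =>
    refine runs_loop_pos (by omega) ?_
    simp only [Prog.block, runs_seq, runs_add, runs_sub, runs_const]
    refine runs_mulLoop (by decide) (by decide) (by decide) (by decide) (by simp [h3]) ?_
    refine (ih (j := j + 1) (by simpa using h3) (by simpa using h16) (by omega)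
      (by simp [h3, h6]; omega) ?_ ?_ (by omega)).mono ?_
    · simp [h16, h6, h4, Nat.descFactorial_succ]
    · rw [Finset.sum_range_succ, ← h5]
      simp [h16, h6, h4, Nat.descFactorial_succ]
    · rintro s' τ ⟨h1, h2, ht, hr, hmem, htoss⟩
      refine ⟨h1, h2, ?_, fun i hi => (hr i hi).trans ?_, hmem, htoss⟩
      · have e1 : k - j = k - (j + 1) + 1 := by omega
        have e2 : (3 * k + 7) * (k - j) = (3 * k + 7) * (k - (j + 1)) + (3 * k + 7) := by
          rw [e1, mul_add, mul_one]
        simp [h6, h16]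
        omega
      · simp only [List.mem_cons, List.not_mem_nil, or_false, not_or] at hi
        simp [hi]

/-- Compute `2 ^ (k - 1) * k!` in register `4` and `k * k! * ∑ i ≤ k, 1 / i!` in register `8`. -/
def setupFraction : Prog :=
  .block [.const 3 1, .const 4 1, .const 5 1, .add 6 0 16, factorialLoop,
  .sub 7 0 3, doubleLoop, .const 8 0, .add 7 0 16, mulLoop 8 5]

/-- Compute the length of the interval and the threshold from the registers `4` and `8`. -/
def setupLength : Prog :=
  .block [.const 1 0, .add 9 4 3, .sub 9 9 8, divLoop, .sub 1 1 3,
  .const 9 2, .add 9 9 1, .add 9 9 9, .const 2 0, .add 7 0 16, mulLoop 2 9]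

theorem runs_setupFraction {ω : ℕ → Bool} {k : ℕ} :
    Runs ω setupFraction (State.init k) fun s τ => s.reg 0 = k ∧ s.reg 3 = 1 ∧ s.reg 16 = 0 ∧
      s.reg 4 = 2 ^ (k - 1) * k.factorial ∧ s.reg 8 = k * expNumerator k ∧
      s.mem = (fun _ => 0) ∧ s.tossed = 0 ∧ τ ≤ 3 * k * k + 13 * k + 20 := by
  simp only [setupFraction, Prog.block, runs_seq, runs_add, runs_sub, runs_const]
  refine (runs_factorialLoop (k := k) (j := 0) (by simp) (by simp [State.init]) (by omega)
    (by simp [State.init]) (by simp) (by simp)).mono ?_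
  rintro s₁ τ₁ ⟨h4, h5, hτ₁, hr, hmem, htoss⟩
  have r0 : s₁.reg 0 = k := by rw [hr 0 (by decide)]; simp [State.init]
  have r3 : s₁.reg 3 = 1 := by rw [hr 3 (by decide)]; simp
  have r16 : s₁.reg 16 = 0 := by rw [hr 16 (by decide)]; simp [State.init]
  have hmem' : s₁.mem = fun _ => 0 := hmem
  have htoss' : s₁.tossed = 0 := htoss
  clear hmem htoss hr
  refine runs_doubleLoop (by simp [r3]) ?_
  refine runs_mulLoop (by decide) (by decide) (by decide) (by decide) (by simp [r3]) ?_
  simp only [State.setReg_reg, State.setReg_mem, State.setReg_tossed]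
  simp [r0, r3, r16, h4, h5, hmem', htoss']
  rw [Nat.sub_zero, add_mul] at hτ₁
  omega

theorem runs_setupLength {ω : ℕ → Bool} {k : ℕ} (hk : 1 ≤ k) {s : State} (h0 : s.reg 0 = k)
    (h3 : s.reg 3 = 1) (h16 : s.reg 16 = 0) (h4 : s.reg 4 = 2 ^ (k - 1) * k.factorial)
    (h8 : s.reg 8 = k * expNumerator k) :
    Runs ω setupLength s fun s' τ => s'.reg 0 = k ∧ s'.reg 1 = size k ∧
      s'.reg 2 = threshold k ∧ s'.reg 3 = 1 ∧ s'.reg 16 = 0 ∧ s'.mem = s.mem ∧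
      s'.tossed = s.tossed ∧ τ ≤ 3 * k + 5 * size k + 20 := by
  simp only [setupLength, Prog.block, runs_seq, runs_add, runs_sub, runs_const]
  refine (runs_divLoop (by simp [h3]) ?_ (by simp [h3])).mono ?_
  · simpa [h8] using ⟨hk, expNumerator_pos k⟩
  rintro s₂ τ₂ ⟨h1, hτ₂, hr₂, hmem₂, htoss₂⟩
  have q0 : s₂.reg 0 = k := by rw [hr₂ 0 (by decide)]; simp [h0]
  have q3 : s₂.reg 3 = 1 := by rw [hr₂ 3 (by decide)]; simp [h3]
  have q16 : s₂.reg 16 = 0 := by rw [hr₂ 16 (by decide)]; simp [h16]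
  have hmem : s₂.mem = s.mem := hmem₂
  have htoss : s₂.tossed = s.tossed := htoss₂
  simp [h4, h8] at h1 hτ₂
  have hsize : s₂.reg 1 - 1 = size k := by rw [h1, size]
  have hτ : τ₂ ≤ 5 * (size k + 1) + 1 := by rw [hτ₂, size]; omega
  clear hmem₂ htoss₂ hr₂ hτ₂ h1
  refine runs_mulLoop (by decide) (by decide) (by decide) (by decide) (by simp [q3]) ?_
  simp only [State.setReg_reg, State.setReg_mem, State.setReg_tossed]
  simp [q0, q3, q16, hsize, hmem, htoss]
  refine ⟨by unfold threshold; ring, ?_⟩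
  omega

/-! ### The recoloring loop -/

/-- Toss the colors of `reg 8` cells, beginning with cell `reg 9`. -/
def colorLoop : Prog := .loop 8 (.block [.toss 10, .store 9 10, .add 9 9 3, .sub 8 8 3])

theorem runs_colorLoop {ω : ℕ → Bool} {s : State} (h3 : s.reg 3 = 1) {m : ℕ}
    (h8 : s.reg 8 = m) :
    Runs ω colorLoop s fun s' τ => SameRegs [8, 9, 10] s s' ∧ s'.tossed = s.tossed + m ∧
      (∀ i < m, s'.mem (s.reg 9 + i) = (ω (s.tossed + i)).toNat) ∧
      (∀ x, (∀ i < m, x ≠ s.reg 9 + i) → s'.mem x = s.mem x) ∧ τ = 5 * m + 1 := by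
  induction m generalizing s with
  | zero => exact runs_loop_zero h8 ⟨fun _ _ => rfl, rfl, by simp, fun _ _ => rfl, rfl⟩
  | succ m ih =>
    refine runs_loop_pos (by omega) ?_
    simp only [Prog.block, runs_seq, runs_add, runs_sub, runs_toss, runs_store]
    refine (ih (by simp [h3]) (by simp [h3, h8])).mono ?_
    rintro s' τ ⟨hr, ht, hm, hm', hτ⟩
    simp [h3] at hr ht hm hm'
    refine ⟨fun i hi => (hr i hi).trans ?_, by omega, ?_, ?_, by omega⟩
    · simp only [List.mem_cons, List.not_mem_nil, or_false, not_or] at hi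
      simp [hi]
    · intro i hi
      rcases i with _ | i
      · rw [hm' _ fun i hi => by omega]; simp
      · rw [← add_assoc, add_right_comm, hm i (by omega), ← add_assoc, add_right_comm]
    · intro x hx
      rw [hm' x fun i hi => by have := hx (i + 1) (by omega); omega, if_neg]
      exact hx 0 (by omega)

/-- Compare the colors of `reg 8` numbers, beginning with `reg 9` and with the difference `reg 5`,
with `reg 12`. -/
def compareLoop : Prog :=
  .loop 8 (.block [.load 11 9, .sub 13 11 12, .add 10 10 13, .sub 13 12 11, .add 10 10 13,
    .add 9 9 5, .sub 8 8 3])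

/-- The two truncated differences add up to the distance of the colors, so register `10` stays `0`
exactly as long as all of them agree. -/
theorem runs_compareLoop {ω : ℕ → Bool} {s : State} (h3 : s.reg 3 = 1) {m : ℕ}
    (h8 : s.reg 8 = m) :
    Runs ω compareLoop s fun s' τ => SameRegs [8, 9, 10, 11, 13] s s' ∧ s'.mem = s.mem ∧
      s'.tossed = s.tossed ∧ s'.reg 9 = s.reg 9 + m * s.reg 5 ∧
      (s'.reg 10 = 0 ↔ s.reg 10 = 0 ∧ ∀ i < m, s.mem (s.reg 9 + i * s.reg 5) = s.reg 12) ∧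
      τ = 8 * m + 1 := by
  induction m generalizing s with
  | zero => exact runs_loop_zero h8 ⟨fun _ _ => rfl, rfl, rfl, by simp, by simp, rfl⟩
  | succ m ih =>
    refine runs_loop_pos (by omega) ?_
    simp only [Prog.block, runs_seq, runs_add, runs_sub, runs_load]
    refine (ih (by simp [h3]) (by simp [h3, h8])).mono ?_
    rintro s' τ ⟨hr, hmem, ht, h9, h10, hτ⟩
    simp at hr hmem ht h9 h10
    refine ⟨fun i hi => (hr i hi).trans ?_, hmem, ht, by rw [h9]; ring, ?_, by omega⟩
    · simp only [List.mem_cons, List.not_mem_nil, or_false, not_or] at hi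
      simp [hi]
    · rw [h10]
      constructor
      · rintro ⟨⟨⟨h, h'⟩, h''⟩, hall⟩
        refine ⟨h, fun i hi => ?_⟩
        rcases i with _ | i
        · rw [zero_mul, add_zero]; omega
        · rw [← hall i (by omega)]; congr 1; ring
      · rintro ⟨h, hall⟩
        have := hall 0 (by omega)
        rw [zero_mul, add_zero] at this
        refine ⟨⟨⟨h, by omega⟩, by omega⟩, fun i hi => ?_⟩
        rw [← hall (i + 1) (by omega)]; congr 1; ring

/-- The memory holds a coloring for which `a, a + d, …, a + (k-1) d` is a monochromatic
progression of `[n]`. -/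
def IsFound (k n : ℕ) (mem : ℕ → ℕ) (a d : ℕ) : Prop :=
  a + k * d ≤ n + d ∧ ∀ i < k, mem (a + i * d) = mem a

/-- Write `(reg 4, reg 5)` to `(reg 6, reg 7)` if this is a monochromatic progression. -/
def check : Prog :=
  .block [.const 10 0, .add 9 4 16, .add 8 0 16, .load 12 4, compareLoop,
  .add 13 1 5, .sub 13 9 13, .add 10 10 13,
  .branch 10 (.const 13 0) (.block [.add 6 4 16, .add 7 5 16])]

theorem runs_check {ω : ℕ → Bool} {s : State} (h3 : s.reg 3 = 1) (h16 : s.reg 16 = 0) :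
    Runs ω check s fun s' τ => SameRegs [6, 7, 8, 9, 10, 11, 12, 13] s s' ∧ s'.mem = s.mem ∧
      s'.tossed = s.tossed ∧
      (IsFound (s.reg 0) (s.reg 1) s.mem (s.reg 4) (s.reg 5) ∧ s'.reg 6 = s.reg 4 ∧
          s'.reg 7 = s.reg 5 ∨
        ¬ IsFound (s.reg 0) (s.reg 1) s.mem (s.reg 4) (s.reg 5) ∧ s'.reg 6 = s.reg 6 ∧
          s'.reg 7 = s.reg 7) ∧ τ ≤ 8 * s.reg 0 + 12 := by
  simp only [check, Prog.block, runs_seq, runs_add, runs_sub, runs_load, runs_const]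
  refine (runs_compareLoop (m := s.reg 0) (by simp [h3]) (by simp [h16])).mono ?_
  rintro s' τ ⟨hr, hmem, ht, h9, h10, hτ⟩
  simp [h16] at h9 h10 hmem ht
  have hr' : SameRegs [6, 7, 8, 9, 10, 11, 12, 13] s s' := fun i hi => by
    simp only [List.mem_cons, List.not_mem_nil, or_false, not_or] at hi
    rw [hr i (by simp [hi])]
    simp [hi]
  have r0 := hr' 0 (by decide)
  have r1 := hr' 1 (by decide)
  have r4 := hr' 4 (by decide)
  have r5 := hr' 5 (by decide)
  have r16 := hr' 16 (by decide)
  have r6 : s'.reg 6 = s.reg 6 := by rw [hr 6 (by decide)]; simp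
  have r7 : s'.reg 7 = s.reg 7 := by rw [hr 7 (by decide)]; simp
  have hiff : s'.reg 10 + (s'.reg 9 - (s'.reg 1 + s'.reg 5)) = 0 ↔
      IsFound (s.reg 0) (s.reg 1) s.mem (s.reg 4) (s.reg 5) := by
    rw [Nat.add_eq_zero_iff, h10, h9, r1, r5, IsFound, Nat.sub_eq_zero_iff_le, and_comm]
  have hset : ∀ s'' : State, (∀ i, i ∉ [6, 7, 8, 9, 10, 11, 12, 13] → s''.reg i = s'.reg i) →
    SameRegs [6, 7, 8, 9, 10, 11, 12, 13] s s'' := fun s'' h => hr'.trans h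
  simp only [runs_branch, runs_seq, runs_add, runs_const]
  constructor
  · intro h
    simp at h
    refine ⟨hset _ fun i hi => ?_, by simpa using hmem, by simpa using ht, Or.inr ⟨?_, ?_, ?_⟩, ?_⟩
    · simp only [List.mem_cons, List.not_mem_nil, or_false, not_or] at hi
      simp [hi]
    · rw [← hiff]; simp; omega
    · simp [r6]
    · simp [r7]
    · simp [h16] at *; omega
  · intro h
    simp at h
    refine ⟨hset _ fun i hi => ?_, by simpa using hmem, by simpa using ht, Or.inl ⟨?_, ?_, ?_⟩, ?_⟩
    · simp only [List.mem_cons, List.not_mem_nil, or_false, not_or] at hi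
      simp [hi]
    · rw [← hiff]; simp; omega
    · simp [r4, r16, h16]
    · simp [r5, r16, h16]
    · simp [h16] at *; omega

/-- Check all differences from `reg 5` down to `1`. -/
def scanDifferences : Prog := .loop 5 (.block [check, .sub 5 5 3])

/-- The scan goes downwards and overwrites earlier finds, so the last one written is the least. The
same principle governs the scan over first members, and together they give the lexicographic
minimum. -/
theorem runs_scanDifferences {ω : ℕ → Bool} {s : State} (h3 : s.reg 3 = 1) (h16 : s.reg 16 = 0)
    {m : ℕ} (h5 : s.reg 5 = m) :
    Runs ω scanDifferences s fun s' τ =>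
      SameRegs [5, 6, 7, 8, 9, 10, 11, 12, 13] s s' ∧ s'.mem = s.mem ∧ s'.tossed = s.tossed ∧
      ((∀ d, 1 ≤ d → d ≤ m → ¬ IsFound (s.reg 0) (s.reg 1) s.mem (s.reg 4) d) ∧
          s'.reg 6 = s.reg 6 ∧ s'.reg 7 = s.reg 7 ∨
        s'.reg 6 = s.reg 4 ∧ 1 ≤ s'.reg 7 ∧ s'.reg 7 ≤ m ∧
          IsFound (s.reg 0) (s.reg 1) s.mem (s.reg 4) (s'.reg 7) ∧
          ∀ d, 1 ≤ d → IsFound (s.reg 0) (s.reg 1) s.mem (s.reg 4) d → s'.reg 7 ≤ d ∨ m < d) ∧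
      τ ≤ m * (8 * s.reg 0 + 14) + 1 := by
  induction m generalizing s with
  | zero =>
    exact runs_loop_zero h5 ⟨fun _ _ => rfl, rfl, rfl, Or.inl ⟨fun d h h' => by omega, rfl, rfl⟩,
      by simp⟩
  | succ m ih =>
    refine runs_loop_pos (by omega) ?_
    rw [Prog.block, Prog.block, runs_seq]
    refine (runs_check h3 h16).mono ?_
    rintro s₁ τ₁ ⟨hr, hmem, ht, hfound, hτ₁⟩
    simp only [runs_sub]
    have r0 := hr 0 (by decide)
    have r1 := hr 1 (by decide)
    have r4 := hr 4 (by decide)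
    have r5 := hr 5 (by decide)
    refine (ih (by simp [hr 3 (by decide), h3]) (by simp [hr 16 (by decide), h16])
      (by simp [hr 3 (by decide), h3, r5, h5])).mono ?_
    rintro s₂ τ₂ ⟨hr₂, hmem₂, ht₂, hfound₂, hτ₂⟩
    simp only [State.setReg_reg, State.setReg_mem, State.setReg_tossed, reduceIte,
      Nat.reduceEqDiff, r0, r1, r4, hmem, ht, OfNat.zero_ne_ofNat,
      OfNat.one_ne_ofNat] at hmem₂ ht₂ hfound₂ hτ₂
    rw [h5] at hfound
    refine ⟨?_, hmem₂, ht₂, ?_, ?_⟩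
    · intro i hi
      rw [hr₂ i hi]
      simp only [List.mem_cons, List.not_mem_nil, or_false, not_or] at hi
      simp only [State.setReg_reg, if_neg hi.1]
      exact hr i (by simp [hi])
    · rcases hfound₂ with ⟨hnone, e6, e7⟩ | ⟨e6, h1, hm, hf, hleast⟩
      · rcases hfound with ⟨hf, e6', e7'⟩ | ⟨hf, e6', e7'⟩
        · refine Or.inr ⟨by omega, by omega, by omega, ?_, fun d hd hfd => ?_⟩
          · rw [e7, e7']; exact hf
          · by_contra! hcon
            exact hnone d hd (by omega) hfd
        · refine Or.inl ⟨fun d hd hdm hfd => ?_, by omega, by omega⟩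
          rcases Nat.lt_or_ge m d with h | h
          · obtain rfl : d = m + 1 := by omega
            exact hf hfd
          · exact hnone d hd h hfd
      · refine Or.inr ⟨e6, h1, by omega, hf, fun d hd hfd => ?_⟩
        rcases hleast d hd hfd with h | h
        · exact Or.inl h
        · left; omega
    · rw [add_mul, one_mul]; omega

/-- Check all first members from `reg 4` down to `1`. -/
def scanMembers : Prog := .loop 4 (.block [.add 5 1 16, scanDifferences, .sub 4 4 3])

theorem runs_scanMembers {ω : ℕ → Bool} {s : State} (h3 : s.reg 3 = 1) (h16 : s.reg 16 = 0)
    {k n m : ℕ} (h0 : s.reg 0 = k) (h1 : s.reg 1 = n) (h4 : s.reg 4 = m) :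
    Runs ω scanMembers s fun s' τ =>
      SameRegs [4, 5, 6, 7, 8, 9, 10, 11, 12, 13] s s' ∧ s'.mem = s.mem ∧
      s'.tossed = s.tossed ∧
      ((∀ a d, 1 ≤ a → a ≤ m → 1 ≤ d → d ≤ n → ¬ IsFound k n s.mem a d) ∧
          s'.reg 6 = s.reg 6 ∧ s'.reg 7 = s.reg 7 ∨
        1 ≤ s'.reg 6 ∧ s'.reg 6 ≤ m ∧ 1 ≤ s'.reg 7 ∧ s'.reg 7 ≤ n ∧
          IsFound k n s.mem (s'.reg 6) (s'.reg 7) ∧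
          ∀ a d, 1 ≤ a → a ≤ m → 1 ≤ d → d ≤ n → IsFound k n s.mem a d →
            s'.reg 6 < a ∨ s'.reg 6 = a ∧ s'.reg 7 ≤ d) ∧
      τ ≤ m * (n * (8 * k + 14) + 4) + 1 := by
  induction m generalizing s with
  | zero =>
    exact runs_loop_zero h4 ⟨fun _ _ => rfl, rfl, rfl,
      Or.inl ⟨fun a d h h' => by omega, rfl, rfl⟩, by simp⟩
  | succ m ih =>
    refine runs_loop_pos (by omega) ?_
    simp only [Prog.block, runs_seq, runs_add]
    refine (runs_scanDifferences (m := n) (by simp [h3]) (by simp [h16])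
      (by simp [h16, h1])).mono ?_
    rintro s₁ τ₁ ⟨hr, hmem, ht, hfound, hτ₁⟩
    simp only [State.setReg_reg, State.setReg_mem, State.setReg_tossed, reduceIte,
      Nat.reduceEqDiff, OfNat.zero_ne_ofNat,
      OfNat.one_ne_ofNat, h0, h1, h4] at hmem ht hfound hτ₁
    have hr' : SameRegs [5, 6, 7, 8, 9, 10, 11, 12, 13] s s₁ := fun i hi => by
      rw [hr i hi]
      simp only [List.mem_cons, List.not_mem_nil, or_false, not_or] at hi
      simp [hi]
    simp only [runs_sub]
    refine (ih (by simp [hr' 3 (by decide), h3]) (by simp [hr' 16 (by decide), h16])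
      (by simp [hr' 0 (by decide), h0]) (by simp [hr' 1 (by decide), h1])
      (by simp [hr' 3 (by decide), h3, hr' 4 (by decide), h4])).mono ?_
    rintro s₂ τ₂ ⟨hr₂, hmem₂, ht₂, hfound₂, hτ₂⟩
    simp only [State.setReg_reg, State.setReg_mem, State.setReg_tossed, reduceIte,
      Nat.reduceEqDiff, hmem, ht] at hmem₂ ht₂ hfound₂
    refine ⟨?_, hmem₂, ht₂, ?_, ?_⟩
    · intro i hi
      rw [hr₂ i hi]
      simp only [List.mem_cons, List.not_mem_nil, or_false, not_or] at hi
      simp only [State.setReg_reg, if_neg hi.1]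
      exact hr' i (by simp [hi])
    · rcases hfound₂ with ⟨hnone, e6, e7⟩ | ⟨ha, ham, hd, hdn, hf, hleast⟩
      · rcases hfound with ⟨hnone', e6', e7'⟩ | ⟨e6', hd, hdn, hf, hleast⟩
        · refine Or.inl ⟨fun a d ha ham hd hdn hfd => ?_, by omega, by omega⟩
          rcases Nat.lt_or_ge m a with h | h
          · obtain rfl : a = m + 1 := by omega
            exact hnone' d hd hdn hfd
          · exact hnone a d ha h hd hdn hfd
        · rw [← e7] at hd hdn hf hleast
          rw [← e6] at e6'
          rw [e6']
          refine Or.inr ⟨by omega, le_rfl, hd, hdn, hf, fun a d ha ham hd hdn hfd => ?_⟩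
          rcases Nat.lt_or_ge m a with h | h
          · obtain rfl : a = m + 1 := by omega
            rcases hleast d hd hfd with h' | h'
            · exact Or.inr ⟨rfl, h'⟩
            · omega
          · exact absurd hfd (hnone a d ha h hd hdn)
      · refine Or.inr ⟨ha, by omega, hd, hdn, hf, fun a d ha' ham' hd' hdn' hfd => ?_⟩
        rcases Nat.lt_or_ge m a with h | h
        · left; omega
        · exact hleast a d ha' h hd' hdn' hfd
    · rw [add_mul, one_mul]; omega

/-- Write the lexicographically least monochromatic progression to `(reg 6, reg 7)`, or `(0, 0)`
if there is none. -/
def scan : Prog := .block [.const 6 0, .const 7 0, .add 4 1 16, scanMembers]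

theorem runs_scan {ω : ℕ → Bool} {s : State} (h3 : s.reg 3 = 1) (h16 : s.reg 16 = 0)
    {k n : ℕ} (h0 : s.reg 0 = k) (h1 : s.reg 1 = n) :
    Runs ω scan s fun s' τ =>
      SameRegs [4, 5, 6, 7, 8, 9, 10, 11, 12, 13] s s' ∧ s'.mem = s.mem ∧
      s'.tossed = s.tossed ∧
      ((∀ a d, 1 ≤ a → a ≤ n → 1 ≤ d → d ≤ n → ¬ IsFound k n s.mem a d) ∧ s'.reg 6 = 0 ∨
        1 ≤ s'.reg 6 ∧ 1 ≤ s'.reg 7 ∧ IsFound k n s.mem (s'.reg 6) (s'.reg 7) ∧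
          ∀ a d, 1 ≤ a → a ≤ n → 1 ≤ d → d ≤ n → IsFound k n s.mem a d →
            s'.reg 6 < a ∨ s'.reg 6 = a ∧ s'.reg 7 ≤ d) ∧
      τ ≤ n * (n * (8 * k + 14) + 4) + 4 := by
  simp only [scan, Prog.block, runs_seq, runs_const, runs_add]
  refine (runs_scanMembers (k := k) (n := n) (m := n) (by simp [h3]) (by simp [h16])
    (by simp [h0]) (by simp [h1]) (by simp [h1, h16])).mono ?_
  rintro s' τ ⟨hr, hmem, ht, hfound, hτ⟩
  simp only [State.setReg_mem, State.setReg_tossed] at hmem ht hfound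
  refine ⟨fun i hi => ?_, hmem, ht, ?_, by omega⟩
  · rw [hr i hi]
    simp only [List.mem_cons, List.not_mem_nil, or_false, not_or] at hi
    simp [hi]
  · rcases hfound with ⟨h, h6, -⟩ | ⟨h, -, h', -, hf, hl⟩
    · exact Or.inl ⟨h, by simpa using h6⟩
    · exact Or.inr ⟨h, h', hf, hl⟩

/-- Recolor and count `reg 8` numbers, beginning with `reg 9` and with the difference `reg 7`;
register `10` becomes nonzero if one of them had been recolored `reg 2` times before. -/
def recolorLoop : Prog :=
  .loop 8 (.block [.add 13 9 1, .load 11 13, .add 12 11 3, .sub 12 12 2, .add 10 10 12,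
    .add 11 11 3, .store 13 11, .toss 11, .store 9 11, .add 9 9 7, .sub 8 8 3])

/-- The counter of `x` lives in cell `n + x`. As all members lie in `[1, n]`, color cells and
counter cells never collide. Register `10` accumulates `cnt + 1 - t`, which is positive exactly when
`t ≤ cnt`. -/
theorem runs_recolorLoop {ω : ℕ → Bool} {s : State} (h3 : s.reg 3 = 1) {n t d m : ℕ}
    (h1 : s.reg 1 = n) (h2 : s.reg 2 = t) (h7 : s.reg 7 = d) (hd : 1 ≤ d) (h8 : s.reg 8 = m)
    {p : ℕ} (h9 : s.reg 9 = p) (hp : 1 ≤ p) (hpn : ∀ i < m, p + i * d ≤ n) :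
    Runs ω recolorLoop s fun s' τ => SameRegs [8, 9, 10, 11, 12, 13] s s' ∧
      s'.tossed = s.tossed + m ∧
      (s'.reg 10 = 0 ↔ s.reg 10 = 0 ∧ ∀ i < m, s.mem (n + (p + i * d)) < t) ∧
      (∀ i < m, s'.mem (p + i * d) = (ω (s.tossed + i)).toNat) ∧
      (∀ i < m, s'.mem (n + (p + i * d)) = s.mem (n + (p + i * d)) + 1) ∧
      (∀ y, (∀ i < m, y ≠ p + i * d ∧ y ≠ n + (p + i * d)) → s'.mem y = s.mem y) ∧
      τ = 12 * m + 1 := by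
  induction m generalizing s p with
  | zero =>
    exact runs_loop_zero h8 ⟨fun _ _ => rfl, rfl, by simp, by simp, by simp, fun _ _ => rfl, rfl⟩
  | succ m ih =>
    have hpn0 := hpn 0 (by omega)
    rw [zero_mul, add_zero] at hpn0
    have hshift : ∀ i, p + d + i * d = p + (i + 1) * d := fun i => by ring
    have hge : ∀ i, d ≤ (i + 1) * d := fun i => Nat.le_mul_of_pos_left d (by omega)
    refine runs_loop_pos (by omega) ?_
    simp only [Prog.block, runs_seq, runs_add, runs_sub, runs_load, runs_store, runs_toss]
    refine (ih (p := p + d) (by simp [h3]) (by simp [h1]) (by simp [h2]) (by simp [h7])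
      (by simp [h3, h8]) (by simp [h7, h9]) (by omega)
      (fun i hi => by rw [hshift]; exact hpn _ (by omega))).mono ?_
    rintro s' τ ⟨hr, ht, h10, hcol, hcnt, hsame, hτ⟩
    simp [h1, h2, h3, h9, hshift] at ht h10 hcol hcnt hsame
    have hne : ∀ i < m, p + (i + 1) * d ≠ p ∧ p + (i + 1) * d ≠ p + n ∧
        n + (p + (i + 1) * d) ≠ p ∧ n + (p + (i + 1) * d) ≠ p + n := fun i hi => by
      have := hge i
      have := hpn (i + 1) (by omega)
      omega
    refine ⟨?_, by omega, ?_, ?_, ?_, ?_, by omega⟩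
    · intro i hi
      rw [hr i hi]
      simp only [List.mem_cons, List.not_mem_nil, or_false, not_or] at hi
      simp [hi]
    · rw [h10]
      constructor
      · rintro ⟨⟨h, h'⟩, hall⟩
        refine ⟨h, fun i hi => ?_⟩
        rcases i with _ | i
        · rw [zero_mul, add_zero, add_comm n p]; omega
        · have := hall i (by omega)
          rwa [if_neg (hne i (by omega)).2.2.1, if_neg (hne i (by omega)).2.2.2] at this
      · rintro ⟨h, hall⟩
        have h0 := hall 0 (by omega)
        rw [zero_mul, add_zero, add_comm n p] at h0
        refine ⟨⟨h, by omega⟩, fun i hi => ?_⟩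
        rw [if_neg (hne i hi).2.2.1, if_neg (hne i hi).2.2.2]
        exact hall (i + 1) (by omega)
    · intro i hi
      rcases i with _ | i
      · rw [zero_mul, add_zero, hsame p fun i hi => ?_]
        · simp
        · have := hne i hi; omega
      · rw [hcol i (by omega)]; congr 2; omega
    · intro i hi
      rcases i with _ | i
      · rw [zero_mul, add_zero, hsame (n + p) fun i hi => ?_]
        · rw [if_neg (by omega), if_pos (add_comm _ _), add_comm n p]
        · have := hne i hi; omega
      · rw [hcnt i (by omega), if_neg (hne i (by omega)).2.2.1, if_neg (hne i (by omega)).2.2.2]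
    · intro y hy
      have h0 := hy 0 (by omega)
      rw [zero_mul, add_zero] at h0
      rw [hsame y fun i hi => hy (i + 1) (by omega), if_neg h0.1, if_neg (by omega)]

/-- One round: find a monochromatic progression and recolor it. Register `14` becomes `0` when the
last round is over, and register `15` becomes `0` when the algorithm fails. -/
def round : Prog :=
  .block [scan,
  .branch 6
    (.block [.const 10 0, .add 9 6 16, .add 8 0 16, recolorLoop,
      .branch 10 (.block [.const 14 0, .const 15 0]) (.const 10 0)])
    (.const 14 0)]

/-- The machine is at the beginning of a round with the coloring `c`, the counters `cnt`, and with
`pos` coins used. -/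
structure State.Represents (s : State) (k n t : ℕ) (c : ℕ → Bool) (cnt : ℕ → ℕ) (pos : ℕ) :
    Prop where
  reg0 : s.reg 0 = k
  reg1 : s.reg 1 = n
  reg2 : s.reg 2 = t
  reg3 : s.reg 3 = 1
  reg14 : s.reg 14 = 1
  reg15 : s.reg 15 = 1
  reg16 : s.reg 16 = 0
  tossed : s.tossed = pos
  color : ∀ x, 1 ≤ x → x ≤ n → s.mem x = (c x).toNat
  count : ∀ x, 1 ≤ x → x ≤ n → s.mem (n + x) = cnt x

/-- The number of steps of one round. -/
def roundCost (k n : ℕ) : ℕ := n * (n * (8 * k + 14) + 4) + 12 * k + 20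

/-- The test `a + k d ≤ n + d` is `a + (k-1) d ≤ n` with `d` added to both sides. It also ensures
that the cells compared are color cells and not counters. -/
theorem isFound_iff {k n : ℕ} (hk : 1 ≤ k) {s : State} {t pos : ℕ} {c : ℕ → Bool} {cnt : ℕ → ℕ}
    (hs : s.Represents k n t c cnt pos) {a d : ℕ} (ha : 1 ≤ a) (hd : 1 ≤ d) :
    IsFound k n s.mem a d ↔ IsAP k n a d ∧ ∀ i < k, c (a + i * d) = c a := by
  have hlen : a + k * d ≤ n + d ↔ IsAP k n a d := by
    have : k * d = (k - 1) * d + d := by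
      rw [← Nat.succ_mul]; congr 1; omega
    unfold IsAP
    omega
  rw [IsFound, hlen]
  refine and_congr_right fun hap => forall_congr' fun i => forall_congr' fun hi => ?_
  have hid : i * d ≤ (k - 1) * d := Nat.mul_le_mul_right _ (by omega)
  have := hap.2.2
  rw [hs.color _ (by omega) (by omega), hs.color a ha (by omega)]
  cases c (a + i * d) <;> cases c a <;> decide

theorem runs_round_some {ω : ℕ → Bool} {k n t : ℕ} (hk : 1 ≤ k)
    (hdn : ∀ a d, IsAP k n a d → d ≤ n) {s : State} {c : ℕ → Bool} {cnt : ℕ → ℕ} {pos : ℕ}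
    (hs : s.Represents k n t c cnt pos) (hex : ∃ a d, IsAP k n a d ∧ ∀ i < k, c (a + i * d) = c a) :
    ∃ a d, IsLeastMono k n c a d ∧ Runs ω round s fun s' τ => τ ≤ roundCost k n ∧
      ((∀ i < k, cnt (a + i * d) < t) ∧
          s'.Represents k n t (recolorBit k a d (fun i => ω (pos + i)) c) (recount k a d cnt)
            (pos + k) ∨
        (∃ i < k, t ≤ cnt (a + i * d)) ∧ s'.reg 1 = n ∧ s'.reg 14 = 0 ∧ s'.reg 15 = 0 ∧
          s'.reg 16 = 0) := by
  have hbound : ∀ a d, IsAP k n a d → a ≤ n ∧ d ≤ n := fun a d h =>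
    ⟨by have := h.2.2; omega, hdn a d h⟩
  obtain ⟨s₁, τ₁, he, hr, hmem, ht, hfound, hτ₁⟩ :=
    runs_scan (ω := ω) hs.reg3 hs.reg16 hs.reg0 hs.reg1
  rcases hfound with ⟨hnone, -⟩ | ⟨ha, hd, hf, hleast⟩
  · obtain ⟨a, d, hap, hm⟩ := hex
    exact absurd ((isFound_iff hk hs hap.1 hap.2.1).2 ⟨hap, hm⟩)
      (hnone a d hap.1 (hbound a d hap).1 hap.2.1 (hbound a d hap).2)
  have hf' := (isFound_iff hk hs ha hd).1 hf
  obtain ⟨a, ha6⟩ : ∃ a, s₁.reg 6 = a := ⟨_, rfl⟩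
  obtain ⟨d, hd7⟩ : ∃ d, s₁.reg 7 = d := ⟨_, rfl⟩
  rw [ha6, hd7] at hf'
  rw [ha6] at ha hleast
  rw [hd7] at hd hleast
  have hmem_le : ∀ i < k, 1 ≤ a + i * d ∧ a + i * d ≤ n := fun i hi => by
    have hid : i * d ≤ (k - 1) * d := Nat.mul_le_mul_right _ (by omega)
    have := hf'.1.2.2
    omega
  refine ⟨a, d, ⟨hf', fun a' d' hap hm => ?_⟩, ?_⟩
  · rw [Prod.Lex.toLex_le_toLex]
    exact hleast a' d' hap.1 (hbound a' d' hap).1 hap.2.1 (hbound a' d' hap).2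
      ((isFound_iff hk hs hap.1 hap.2.1).2 ⟨hap, hm⟩)
  rw [round, Prog.block, Prog.block, runs_seq]
  refine ⟨s₁, τ₁, he, ?_⟩
  beta_reduce
  have r0 : s₁.reg 0 = k := (hr 0 (by decide)).trans hs.reg0
  have r1 : s₁.reg 1 = n := (hr 1 (by decide)).trans hs.reg1
  have r2 : s₁.reg 2 = t := (hr 2 (by decide)).trans hs.reg2
  have r3 : s₁.reg 3 = 1 := (hr 3 (by decide)).trans hs.reg3
  have r14 : s₁.reg 14 = 1 := (hr 14 (by decide)).trans hs.reg14
  have r15 : s₁.reg 15 = 1 := (hr 15 (by decide)).trans hs.reg15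
  have r16 : s₁.reg 16 = 0 := (hr 16 (by decide)).trans hs.reg16
  rw [runs_branch]
  refine ⟨fun _ => ?_, fun h => by omega⟩
  simp only [Prog.block, runs_seq, runs_const, runs_add]
  refine (runs_recolorLoop (n := n) (t := t) (d := d) (m := k) (p := a) (by simp [r3])
    (by simp [r1]) (by simp [r2]) (by simp [hd7]) hd (by simp [r0, r16]) (by simp [ha6, r16]) ha
    fun i hi => (hmem_le i hi).2).mono ?_
  rintro s₂ τ₂ ⟨hr₂, ht₂, h10, hcol, hcnt, hsame, hτ₂⟩
  simp only [State.setReg_reg, State.setReg_mem, State.setReg_tossed, reduceIte,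
    Nat.reduceEqDiff, hmem, ht, hs.tossed, true_and] at ht₂ h10 hcol hcnt hsame
  have q0 : s₂.reg 0 = k := by rw [hr₂ 0 (by decide)]; simp [r0]
  have q1 : s₂.reg 1 = n := by rw [hr₂ 1 (by decide)]; simp [r1]
  have q2 : s₂.reg 2 = t := by rw [hr₂ 2 (by decide)]; simp [r2]
  have q3 : s₂.reg 3 = 1 := by rw [hr₂ 3 (by decide)]; simp [r3]
  have q14 : s₂.reg 14 = 1 := by rw [hr₂ 14 (by decide)]; simp [r14]
  have q15 : s₂.reg 15 = 1 := by rw [hr₂ 15 (by decide)]; simp [r15]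
  have q16 : s₂.reg 16 = 0 := by rw [hr₂ 16 (by decide)]; simp [r16]
  have hcount : ∀ i < k, s.mem (n + (a + i * d)) = cnt (a + i * d) := fun i hi =>
    hs.count _ (hmem_le i hi).1 (hmem_le i hi).2
  have hcost : ∀ x ≤ 2, 1 + (1 + (1 + (τ₂ + (x + 1)))) + 1 + τ₁ ≤ roundCost k n := fun x hx => by
    unfold roundCost; omega
  simp only [runs_branch, runs_seq, runs_const]
  constructor
  · intro hbad
    refine ⟨by have := hcost 2 le_rfl; omega, Or.inr ⟨?_, by simp [q1], by simp, by simp,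
      by simp [q16]⟩⟩
    by_contra! hcon
    exact hbad (h10.2 fun i hi => by rw [hcount i hi]; exact hcon i hi)
  · intro hok
    have hlt := h10.1 hok
    refine ⟨by have := hcost 1 (by omega); omega, Or.inl
      ⟨fun i hi => by rw [← hcount i hi]; exact hlt i hi, ?_⟩⟩
    refine ⟨by simp [q0], by simp [q1], by simp [q2], by simp [q3], by simp [q14], by simp [q15],
      by simp [q16], by simp [ht₂], fun x hx hxn => ?_, fun x hx hxn => ?_⟩
    · rw [State.setReg_mem]
      by_cases hmemx : ∃ i < k, x = a + i * d
      · obtain ⟨i, hi, rfl⟩ := hmemx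
        rw [hcol i hi, recolorBit_mem hd hi]
      · push Not at hmemx
        rw [recolorBit_of_ne hd hmemx, ← hs.color x hx hxn]
        refine hsame x fun i hi => ⟨hmemx i hi, ?_⟩
        have := (hmem_le i hi).1
        omega
    · rw [State.setReg_mem, recount]
      by_cases hmemx : ∃ i < k, x = a + i * d
      · rw [if_pos ((mem_progression_iff hd).2 hmemx)]
        obtain ⟨i, hi, rfl⟩ := hmemx
        rw [hcnt i hi, hcount i hi]
      · rw [if_neg fun h => hmemx ((mem_progression_iff hd).1 h), ← hs.count x hx hxn]
        push Not at hmemx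
        refine hsame _ fun i hi => ⟨?_, ?_⟩
        · have := (hmem_le i hi).2
          omega
        · have := hmemx i hi
          omega

theorem runs_round_none {ω : ℕ → Bool} {k n t : ℕ} (hk : 1 ≤ k) {s : State} {c : ℕ → Bool}
    {cnt : ℕ → ℕ} {pos : ℕ} (hs : s.Represents k n t c cnt pos)
    (hex : ¬ ∃ a d, IsAP k n a d ∧ ∀ i < k, c (a + i * d) = c a) :
    Runs ω round s fun s' τ => τ ≤ roundCost k n ∧ s'.reg 1 = n ∧ s'.reg 14 = 0 ∧
      s'.reg 15 = 1 ∧ s'.reg 16 = 0 ∧ s'.mem = s.mem := by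
  rw [round, Prog.block, Prog.block, runs_seq]
  refine (runs_scan hs.reg3 hs.reg16 hs.reg0 hs.reg1).mono ?_
  rintro s₁ τ₁ ⟨hr, hmem, -, hfound, hτ₁⟩
  rcases hfound with ⟨-, h6⟩ | ⟨ha, hd, hf, -⟩
  · rw [runs_branch]
    refine ⟨fun h => absurd h6 h, fun _ => ?_⟩
    rw [runs_const]
    refine ⟨by unfold roundCost; omega, ?_, by simp, ?_, ?_, hmem⟩
    · simpa [hs.reg1] using hr 1 (by decide)
    · simpa [hs.reg15] using hr 15 (by decide)
    · simpa [hs.reg16] using hr 16 (by decide)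
  · exact absurd ⟨_, _, (isFound_iff hk hs ha hd).1 hf⟩ hex

/-- The number of recolorings still permitted is a potential that bounds the number of rounds for
every sequence of tosses. -/
theorem sum_sub_recount_lt {k n t a d : ℕ} (hk : 1 ≤ k) {cnt : ℕ → ℕ} (hap : IsAP k n a d)
    (hlt : ∀ i < k, cnt (a + i * d) < t) :
    ∑ x ∈ Finset.Icc 1 n, (t - recount k a d cnt x) < ∑ x ∈ Finset.Icc 1 n, (t - cnt x) := by
  obtain ⟨ha, hd, hn⟩ := hap
  refine Finset.sum_lt_sum (fun x _ => ?_) ⟨a, Finset.mem_Icc.2 ⟨ha, by omega⟩, ?_⟩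
  · unfold recount; split_ifs <;> omega
  · have := hlt 0 hk
    rw [zero_mul, add_zero] at this
    rw [recount, if_pos ((mem_progression_iff hd).2 ⟨0, hk, by simp⟩)]
    omega

/-- The rounds carry out the recoloring loop, and a failure comes with a long chain. -/
theorem runs_rounds {ω : ℕ → Bool} {k n t : ℕ} (hk : 1 ≤ k) (hdn : ∀ a d, IsAP k n a d → d ≤ n)
    {s : State} {c : ℕ → Bool} {cnt : ℕ → ℕ} {pos m : ℕ} (hs : s.Represents k n t c cnt pos)
    (hm : ∑ x ∈ Finset.Icc 1 n, (t - cnt x) ≤ m) :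
    Runs ω (.loop 14 round) s fun s' τ => τ ≤ (m + 1) * (roundCost k n + 1) + 1 ∧
      s'.reg 1 = n ∧ s'.reg 16 = 0 ∧ ∃ out, MTLoop k n t ω (fun x => (c x).toNat) cnt pos out ∧
        (out = none ∧ s'.reg 15 = 0 ∧
            (∃ w b c', Chain k n ω c pos w b c' ∧ ∃ x, t ≤ cnt x + w.length) ∨
          ∃ col, out = some col ∧ s'.reg 15 = 1 ∧ ∀ x, 1 ≤ x → x ≤ n → s'.mem x = col x) := by
  induction m using Nat.strong_induction_on generalizing s c cnt pos with
  | _ m ih =>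
  refine runs_loop_pos (by rw [hs.reg14]; decide) ?_
  have hcost : ∀ m, (m + 1) * (roundCost k n + 1) = m * (roundCost k n + 1) + roundCost k n + 1 :=
    fun m => by ring
  by_cases hex : ∃ a d, IsAP k n a d ∧ ∀ i < k, c (a + i * d) = c a
  · obtain ⟨a, d, hl, hrun⟩ := runs_round_some (ω := ω) hk hdn hs hex
    refine hrun.mono ?_
    rintro s₁ τ₁ ⟨hτ₁, ⟨hlt, hs₁⟩ | ⟨hge, h1, h14, h15, h16⟩⟩
    · have hdec := sum_sub_recount_lt hk hl.1.1 hlt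
      refine (ih (m - 1) (by omega) hs₁ (by omega)).mono ?_
      rintro s₂ τ₂ ⟨hτ₂, h1, h16, out, hout, hres⟩
      refine ⟨?_, h1, h16, out, ?_, ?_⟩
      · rw [show m - 1 + 1 = m by omega] at hτ₂
        rw [hcost]
        omega
      · rw [← recolor_toNat] at hout
        exact .step hl.1.1 (mono_toNat_iff.2 hl.1.2) hlt hout
      · rcases hres with ⟨h, h15, w, b, c', hc, x, hx⟩ | h
        -- A round raises the counter of the witness `x` by at most one and lengthens the chain by
        -- one, so the inequality carries over to the state before the round.
        · refine Or.inl ⟨h, h15, _, _, c', .cons hl hc, x, hx.trans ?_⟩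
          rw [List.length_cons, recount]
          split_ifs <;> omega
        · exact Or.inr h
    · refine runs_loop_zero h14 ⟨by rw [hcost]; omega, h1, h16, none,
        .fail hl.1.1 (mono_toNat_iff.2 hl.1.2) hge, Or.inl ⟨rfl, h15, ?_⟩⟩
      obtain ⟨i, -, hi⟩ := hge
      exact ⟨[], [], c, .nil, a + i * d, by simpa using hi⟩
  · refine (runs_round_none hk hs hex).mono ?_
    rintro s₁ τ₁ ⟨hτ₁, h1, h14, h15, h16, hmem⟩
    refine runs_loop_zero h14 ⟨by rw [hcost]; omega, h1, h16, _,
      .done fun a d hap hmono => hex ⟨a, d, hap, mono_toNat_iff.1 hmono⟩,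
      Or.inr ⟨_, rfl, h15, fun x hx hxn => ?_⟩⟩
    rw [hmem]
    exact hs.color x hx hxn

/-! ### The whole program: correctness, running time, success probability -/

/-- The whole program. -/
def program : Prog :=
  .block [setupFraction, setupLength, .add 9 3 16, .add 8 1 16, colorLoop,
    .const 14 1, .const 15 1, .loop 14 round, .add 0 15 16]

/-- The number of steps of the whole program. -/
def programCost (k n t : ℕ) : ℕ :=
  (n * t + 1) * (roundCost k n + 1) + 3 * k * k + 16 * k + 10 * n + 60

/-- The scan tries only differences up to `n`. For `k = 1` the progression condition does not bound
`d`, but then the interval is empty. -/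
theorem le_size_of_isAP {k a d : ℕ} (hk : 1 ≤ k) (h : IsAP k (size k) a d) : d ≤ size k := by
  obtain ⟨ha, hd, hn⟩ := h
  rcases Nat.lt_or_ge k 2 with h2 | h2
  · rw [size_of_le_four hk (by omega)] at hn
    omega
  · have : d ≤ (k - 1) * d := Nat.le_mul_of_pos_left d (by omega)
    omega

theorem runs_program {ω : ℕ → Bool} {k : ℕ} (hk : 1 ≤ k) :
    Runs ω program (State.init k) fun s τ => τ ≤ programCost k (size k) (threshold k) ∧
      ∃ out, MoserTardos k (size k) (threshold k) ω out ∧ s.Reports (size k) out ∧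
        (out = none → ∃ w b c', w.length = threshold k ∧
          Chain k (size k) ω (fun x => ω (x - 1)) (size k) w b c') := by
  simp only [program, Prog.block, runs_seq]
  refine runs_setupFraction.mono ?_
  rintro s₁ τ₁ ⟨h0, h3, h16, h4, h8, hmem, ht, hτ₁⟩
  refine (runs_setupLength hk h0 h3 h16 h4 h8).mono ?_
  rintro s₂ τ₂ ⟨q0, q1, q2, q3, q16, hmem₂, ht₂, hτ₂⟩
  simp only [runs_add, runs_const]
  refine (runs_colorLoop (m := size k) (by simp [q3]) (by simp [q1, q16])).mono ?_
  rintro s₃ τ₃ ⟨hr, ht₃, hcol, hsame, hτ₃⟩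
  simp only [State.setReg_reg, State.setReg_mem, State.setReg_tossed, reduceIte,
    Nat.reduceEqDiff, hmem₂, hmem, ht₂, ht, q3, q16, add_zero, zero_add] at ht₃ hcol hsame
  have hrep : ((s₃.setReg 14 1).setReg 15 1).Represents k (size k) (threshold k)
      (fun x => ω (x - 1)) (fun _ => 0) (size k) := by
    refine ⟨?_, ?_, ?_, ?_, by simp, by simp, ?_, by simpa using ht₃, fun x hx hxn => ?_,
      fun x hx hxn => ?_⟩
    · simp [hr 0 (by decide), q0]
    · simp [hr 1 (by decide), q1]
    · simp [hr 2 (by decide), q2]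
    · simp [hr 3 (by decide), q3]
    · simp [hr 16 (by decide), q16]
    · have := hcol (x - 1) (by omega)
      rwa [show 1 + (x - 1) = x by omega] at this
    · exact hsame _ fun i hi => by omega
  refine (runs_rounds hk (fun a d h => le_size_of_isAP hk h) hrep
    (m := size k * threshold k) (by simp)).mono ?_
  rintro s₄ τ₄ ⟨hτ₄, r1, r16, out, hout, hres⟩
  refine ⟨by unfold programCost; omega, out, hout, ?_, ?_⟩
  · rcases hres with ⟨rfl, h15, -⟩ | ⟨col, rfl, h15, hcol'⟩
    · simp [State.Reports, State.Failed, h15, r16]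
    · exact ⟨by simp [h15, r16], by simp [r1], fun x hx hxn => by simpa using hcol' x hx hxn⟩
  · rintro rfl
    rcases hres with ⟨-, -, w, b, c', hc, x, hx⟩ | ⟨col, h, -⟩
    · rw [zero_add] at hx
      -- Counters start at `0`, so a failure has at least `threshold k` rounds before it; the chain
      -- is cut to the exact length of the probability estimate.
      obtain ⟨w₁, b₁, c₁, hw, hc⟩ := hc.truncate hx
      exact ⟨w₁, b₁, c₁, hw, hc⟩
    · cases h

theorem MTLoop.isProper {k n t : ℕ} {ω : ℕ → Bool} {col cnt : ℕ → ℕ} {pos : ℕ}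
    {out : Option (ℕ → ℕ)} (h : MTLoop k n t ω col cnt pos out) (hcol : ∀ x, col x < 2)
    {col' : ℕ → ℕ} (hout : out = some col') : IsProper k 2 n col' := by
  induction h with
  | done h => cases hout; exact ⟨fun x _ _ => hcol x, h⟩
  | step _ _ _ _ ih =>
    refine ih (fun x => ?_) hout
    unfold recolor
    split_ifs
    · exact Bool.toNat_lt _
    · exact hcol x
  | fail => cases hout

/-- Everything is bounded through `z = 9 n'`, which dominates `k`, `size k` and `1`. The polynomial
is written in `f + 1 = n'` because `f` itself can be negative. -/
theorem programCost_le {k : ℕ} (hk : 1 ≤ k) :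
    (programCost k (size k) (threshold k) : ℝ) ≤ 1000 * (9 * (nPrime k - 1 + 1)) ^ 7 := by
  have h1 : (1 : ℝ) ≤ k := by exact_mod_cast hk
  have hn := size_le_nPrime hk
  have hk9 := le_nine_mul_nPrime hk
  have h0 : (0 : ℝ) ≤ size k := Nat.cast_nonneg _
  rw [sub_add_cancel]
  obtain ⟨z, hz⟩ : ∃ z, z = 9 * nPrime k := ⟨_, rfl⟩
  rw [← hz] at hk9 ⊢
  have hnz : (size k : ℝ) ≤ z := by linarith [nPrime_pos hk]
  have hz1 : 1 ≤ z := h1.trans hk9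
  have hz0 : 0 ≤ z := by linarith
  have ht : (threshold k : ℝ) ≤ 6 * z ^ 2 := by
    unfold threshold
    push_cast
    calc 2 * (k : ℝ) * (size k + 2) ≤ 2 * z * (z + 2 * z) := by gcongr; linarith
      _ = 6 * z ^ 2 := by ring
  have hround : (roundCost k (size k) : ℝ) + 1 ≤ 59 * z ^ 3 := by
    unfold roundCost
    push_cast
    calc (size k : ℝ) * (size k * (8 * k + 14) + 4) + 12 * k + 20 + 1
        ≤ z * (z * (8 * z + 14) + 4) + 12 * z + 20 + 1 := by gcongr
      _ = 8 * z ^ 3 + 14 * z ^ 2 + 16 * z ^ 1 + 21 * z ^ 0 := by ring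
      _ ≤ 8 * z ^ 3 + 14 * z ^ 3 + 16 * z ^ 3 + 21 * z ^ 3 := by
          gcongr <;> first | exact hz1 | decide
      _ = 59 * z ^ 3 := by ring
  unfold programCost
  push_cast
  calc ((size k : ℝ) * threshold k + 1) * (roundCost k (size k) + 1) + 3 * k * k + 16 * k +
        10 * size k + 60
      ≤ (z * (6 * z ^ 2) + 1) * (59 * z ^ 3) + 3 * z * z + 16 * z + 10 * z + 60 := by gcongr
    _ = 354 * z ^ 6 + 59 * z ^ 3 + 3 * z ^ 2 + 26 * z ^ 1 + 60 * z ^ 0 := by ring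
    _ ≤ 354 * z ^ 7 + 59 * z ^ 7 + 3 * z ^ 7 + 26 * z ^ 7 + 60 * z ^ 7 := by
        gcongr <;> first | exact hz1 | decide
    _ ≤ 1000 * z ^ 7 := by nlinarith [pow_nonneg hz0 7]

/-- The probability that the recoloring algorithm needs at least `threshold k` rounds. -/
theorem coins_long_chain_le {k : ℕ} (hk : 1 ≤ k) :
    coins {ω | ∃ w b c', w.length = threshold k ∧
      Chain k (size k) ω (fun x => ω (x - 1)) (size k) w b c'} ≤ 1 / 3 := by
  rcases le_or_gt k 4 with hk4 | hk5
  · have hsize := size_of_le_four hk hk4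
    rw [show {ω | _} = (∅ : Set (ℕ → Bool)) from ?_, MeasureTheory.measure_empty]
    · exact zero_le
    refine Set.eq_empty_of_forall_notMem ?_
    rintro ω ⟨w, b, c', hw, h⟩
    cases h with
    | nil => simp [threshold] at hw; omega
    | cons hl _ => have := hl.1.1; rw [hsize] at this; unfold IsAP at this; omega
  · exact coins_chain_le_third hk5 (size_le_nPrime hk)

/-- Subadditivity over the cover `S ∪ F` avoids complements, hence any question of measurability. -/
theorem two_thirds_le_coins {S F : Set (ℕ → Bool)} (h : ∀ ω, ω ∈ S ∨ ω ∈ F)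
    (hF : coins F ≤ 1 / 3) : (2 / 3 : ENNReal) ≤ coins S := by
  have h1 : 1 ≤ coins S + 1 / 3 := by
    calc 1 = coins Set.univ := MeasureTheory.measure_univ.symm
      _ ≤ coins (S ∪ F) := MeasureTheory.measure_mono fun ω _ => h ω
      _ ≤ coins S + coins F := MeasureTheory.measure_union_le _ _
      _ ≤ coins S + 1 / 3 := by gcongr
  refine (ENNReal.add_le_add_iff_right (a := 1 / 3) ?_).1 (le_trans (le_of_eq ?_) h1)
  · exact ENNReal.div_ne_top (by simp) (by simp)
  · rw [ENNReal.div_add_div_same, show (2 : ENNReal) + 1 = 3 by norm_num]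
    exact ENNReal.div_self (by simp) (by simp)

theorem program_randomizedConstructive :
    RandomizedConstructive program 2 fun k => (2 : ℝ) ^ (k - 1) / (Real.exp 1 * k) - 1 := by
  refine ⟨Polynomial.C 1000 * (Polynomial.C 9 * (Polynomial.X + 1)) ^ 7, fun k hk => ?_⟩
  have hproper : ∀ {ω : ℕ → Bool} {s : State} {col : ℕ → ℕ},
      MoserTardos k (size k) (threshold k) ω (some col) → s.Reports (size k) (some col) →
      s.OutputsProper k 2 ((2 : ℝ) ^ (k - 1) / (Real.exp 1 * k) - 1) := fun hmt hrep =>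
    ⟨size k, _, floor_le_size hk, MTLoop.isProper hmt (fun _ => Bool.toNat_lt _) rfl, hrep⟩
  constructor
  · intro ω
    obtain ⟨s, τ, he, hτ, out, hmt, hrep, -⟩ := runs_program (ω := ω) hk
    refine ⟨s, τ, he, ?_, ?_⟩
    · have := programCost_le hk
      simp only [Polynomial.eval_mul, Polynomial.eval_C, Polynomial.eval_pow, Polynomial.eval_add,
        Polynomial.eval_X, Polynomial.eval_one]
      exact (Nat.cast_le.2 hτ).trans this
    · cases out with
      | none => exact Or.inr hrep
      | some col => exact Or.inl (hproper hmt hrep)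
  · refine two_thirds_le_coins (fun ω => ?_) (coins_long_chain_le hk)
    obtain ⟨s, τ, he, -, out, hmt, hrep, hfail⟩ := runs_program (ω := ω) hk
    cases out with
    | none => exact Or.inr (hfail rfl)
    | some col => exact Or.inl ⟨s, τ, he, hproper hmt hrep⟩

/-- An event of positive probability is nonempty, so some tosses produce a proper coloring of an
interval of length at least `⌊f k⌋`. The rounding is harmless because `W` is strictly larger than
that length. -/
theorem le_vdW_of_randomizedConstructive {p : Prog} {c : ℕ} {f : ℕ → ℝ}
    (h : RandomizedConstructive p c f) {k : ℕ} (hk : 1 ≤ k) : f k ≤ vdW k c := by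
  obtain ⟨q, hq⟩ := h
  obtain ⟨-, hprob⟩ := hq k hk
  obtain ⟨ω, s, τ, -, n, col, hn, hcol, -⟩ := MeasureTheory.nonempty_of_measure_ne_zero
    (ne_of_gt (lt_of_lt_of_le (ENNReal.div_pos (by simp) (by simp)) hprob))
  have h1 : ((⌊f k⌋₊ + 1 : ℕ) : ℝ) ≤ vdW k c := by
    exact_mod_cast (Nat.succ_le_succ hn).trans (lt_vdW hk hcol)
  push_cast at h1
  exact (Nat.lt_floor_add_one (f k)).le.trans h1

end VdW

end

theorem corollary7p2 :
    (∀ k : ℕ, 1 ≤ k → (2 : ℝ) ^ (k - 1) / (Real.exp 1 * k) - 1 ≤ (VdW.vdW k 2 : ℝ)) ∧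
    ∃ (p : VdW.Prog) (ε : ℕ → ℝ) (n t : ℕ → ℕ) (c₁ c₂ C : ℝ),
      -- the program makes the bound randomized-constructive
      VdW.RandomizedConstructive p 2 (fun k => (2 : ℝ) ^ (k - 1) / (Real.exp 1 * k) - 1) ∧
      0 < c₁ ∧
      ∀ k : ℕ, 1 ≤ k →
        -- the parameters: `ε` is of order `1 / (n' k)` and `t = O(ε ^ (-1.01))`
        c₁ / (VdW.nPrime k * k) ≤ ε k ∧ ε k ≤ c₂ / (VdW.nPrime k * k) ∧
        VdW.nPrime k - 1 ≤ (2 : ℝ) ^ (((k : ℝ) - 1) * (1 - ε k)) / (Real.exp 1 * k) ∧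
        n k = ⌊(2 : ℝ) ^ (((k : ℝ) - 1) * (1 - ε k)) / (Real.exp 1 * k)⌋₊ ∧
        (t k : ℝ) ≤ C * ε k ^ (-(1.01 : ℝ)) ∧
        -- the program runs the recoloring algorithm on `[n k]` with threshold `t k`
        ∀ ω : ℕ → Bool, ∃ s τ out,
          VdW.Exec ω p (VdW.State.init k) s τ ∧
          VdW.MoserTardos k (n k) (t k) ω out ∧ s.Reports (n k) out := by
  refine ⟨fun k hk =>
    VdW.le_vdW_of_randomizedConstructive VdW.program_randomizedConstructive hk, ?_⟩
  choose! ε hε using fun k => @VdW.exists_exponent k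
  refine ⟨VdW.program, ε, VdW.size, VdW.threshold, 1 / 2, 20, 16800,
    VdW.program_randomizedConstructive, by norm_num, fun k hk => ?_⟩
  obtain ⟨h1, h2, h3, h4⟩ := hε k hk
  have hk' : (0 : ℝ) < k := by exact_mod_cast hk
  have hpos : 0 < ε k :=
    lt_of_lt_of_le (div_pos (by norm_num) (mul_pos (VdW.nPrime_pos hk) hk')) h1
  refine ⟨h1, h2, h3, h4, VdW.threshold_le hk hpos h2, fun ω => ?_⟩
  obtain ⟨s, τ, he, -, out, hmt, hrep, -⟩ := VdW.runs_program (ω := ω) hk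
  exact ⟨s, τ, out, he, hmt, hrep⟩
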